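/- Let $k$ be a field of characteristic different from $2$; all vector spaces and (multi)linear maps are over $k$. **2-term homotopy Lie triple systems.** Such an object $\mathcal T$ consists of a complex $d:T_{-1}\to T_0$, trilinear brackets $[x,y,z]\in T_0$ and $[f,x,y],[x,f,y],[x,y,f]\in T_{-1}$ ($x,y,z\in T_0$, $f\in T_{-1}$), and a 5-linear map $J:T_0^5\to T_{-1}$, such that for all $x,y,z,x_i\in T_0$ and $f,g\in T_{-1}$: - $d[x,y,f]=[x,y,df]$, $d[x,f,y]=[x,df,y]$, $[df,g,x]=[f,dg,x]$, $[df,x,g]=[f,x,dg]$; - $[x,y,z]=-[y,x,z]$, $[x,y,f]=-[y,x,f]$, $[x,f,y]=-[f,x,y]$; - $[x,y,z]+[y,z,x]+[z,x,y]=0$, $[x,y,f]+[y,f,x]+[f,x,y]=0$; - $J(x_1,x_2,x,x,y)=0$ and $J(x_1,x_2,x,y,z)+J(x_1,x_2,y,z,x)+J(x_1,x_2,z,x,y)=0$; - with $E(x_1,\dots,x_5)=-[x_1,x_2,[x_3,x_4,x_5]]+[x_3,[x_1,x_2,x_4],x_5]+[[x_1,x_2,x_3],x_4,x_5]+[x_3,x_4,[x_1,x_2,x_5]]$: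 $dJ=E$ on $T_0^5$, and $J(\dots,df,\dots)=E(\dots,f,\dots)$ when a single argument, in position $1$, $2$, $3$ or $5$, is $df$ resp. $f\in T_{-1}$; - $[J(x_1,x_2,x_3,x_4,x_5),x_6,x_7]+[x_5,J(x_1,x_2,x_3,x_4,x_6),x_7]+[x_1,x_2,J(x_3,x_4,x_5,x_6,x_7)]+[x_5,x_6,J(x_1,x_2,x_3,x_4,x_7)]+J(x_1,x_2,[x_3,x_4,x_5],x_6,x_7)+J(x_1,x_2,x_5,[x_3,x_4,x_6],x_7)+J(x_1,x_2,x_5,x_6,[x_3,x_4,x_7])$ $=[x_3,x_4,J(x_1,x_2,x_5,x_6,x_7)]+J([x_1,x_2,x_3],x_4,x_5,x_6,x_7)+J(x_3,[x_1,x_2,x_4],x_5,x_6,x_7)+J(x_3,x_4,[x_1,x_2,x_5],x_6,x_7)+J(x_3,x_4,x_5,[x_1,x_2,x_6],x_7)+J(x_1,x_2,x_3,x_4,[x_5,x_6,x_7])+J(x_3,x_4,x_5,x_6,[x_1,x_2,x_7])$. A *homomorphism* $\varphi:\mathcal T\to\mathcal T'$ is a chain map $(\varphi_0,\varphi_1)$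 with a trilinear map $\varphi_2:T_0^3\to T'_{-1}$ such that $\varphi_2(x,x,y)=0$, $\varphi_2(x,y,z)+\varphi_2(y,z,x)+\varphi_2(z,x,y)=0$, $d\varphi_2(x,y,z)=\varphi_0[x,y,z]-[\varphi_0x,\varphi_0y,\varphi_0z]$, $\varphi_2(x,y,df)=\varphi_1[x,y,f]-[\varphi_0x,\varphi_0y,\varphi_1f]$, $\varphi_2(x,df,y)=\varphi_1[x,f,y]-[\varphi_0x,\varphi_1f,\varphi_0y]$, and $$J(\varphi_0x_1,\dots,\varphi_0x_5)+[\varphi_2(x_1,x_2,x_3),\varphi_0x_4,\varphi_0x_5]+[\varphi_0x_3,\varphi_2(x_1,x_2,x_4),\varphi_0x_5]+[\varphi_0x_3,\varphi_0x_4,\varphi_2(x_1,x_2,x_5)]$$ $$+\varphi_2([x_1,x_2,x_3],x_4,x_5)+\varphi_2(x_3,[x_1,x_2,x_4],x_5)+\varphi_2(x_3,x_4,[x_1,x_2,x_5])$$ $$=[\varphi_0x_1,\varphi_0x_2,\varphi_2(x_3,x_4,x_5)]+\varphi_2(x_1,x_2,[x_3,x_4,x_5])+\varphi_1J(x_1,\dots,x_5).$$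 Composition: $(\psi\varphi)_i=\psi_i\varphi_i$ for $i=0,1$, and $(\psi\varphi)_2(x,y,z)=\psi_2(\varphi_0x,\varphi_0y,\varphi_0z)+\psi_1\varphi_2(x,y,z)$; the identity is $(1,1,0)$. A *2-homomorphism* $\tau:\varphi\Rightarrow\psi$ is a linear map $\tau:T_0\to T'_{-1}$ with $d\tau=\psi_0-\varphi_0$, $\tau d=\psi_1-\varphi_1$ and $$\varphi_2(x,y,z)-\psi_2(x,y,z)=[\varphi_0x,\varphi_0y,\tau z]+[\varphi_0x,\tau y,\varphi_0z]+[\tau x,\varphi_0y,\varphi_0z]+[d\tau x,\tau y,\varphi_0z]+[d\tau x,\varphi_0y,\tau z]+[\varphi_0x,d\tau y,\tau z]+[d\tau x,d\tau y,\tau z]-\tau[x,y,z].$$ Vertical composition is addition. The horizontal composite of $\tau:\varphi\Rightarrow\psi$ followed by $\tau':\varphi'\Rightarrow\psi'$ is $\tau'\psi_0+\varphi'_1\tau$. **Lie triple 2-systems.** A 2-vector space is a category internal to $k$-vector spaces (objects $L_0$, morphisms $L_1$, source $s$, target $t$, identities $1_x$, linear composition). A *Lie triple 2-system* is a 2-vector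 space $L$ with a trilinear functor $\{\cdot,\cdot,\cdot\}:L\times L\times L\to L$ satisfying $\{x,x,y\}=0$ and $\{x,y,z\}+\{y,z,x\}+\{z,x,y\}=0$ on objects and on morphisms, and a 5-linear natural isomorphism (the fundamentor) $$\mathcal J_{x_1,\dots,x_5}:\{x_1,x_2,\{x_3,x_4,x_5\}\}\to\{\{x_1,x_2,x_3\},x_4,x_5\}+\{x_3,\{x_1,x_2,x_4\},x_5\}+\{x_3,x_4,\{x_1,x_2,x_5\}\}$$ with $\mathcal J_{x_1,x_2,x,x,y}=0$ and $\mathcal J_{x_1,x_2,x,y,z}+\mathcal J_{x_1,x_2,y,z,x}+\mathcal J_{x_1,x_2,z,x,y}=0$, such that, for all $x_1,\dots,x_7$, the following two composites from $\{x_1,x_2,\{x_3,x_4,\{x_5,x_6,x_7\}\}\}$ agree (identities on unchanged summands are suppressed; an object among morphisms means its identity): - first $\{x_1,x_2,\mathcal J_{x_3,x_4,x_5,x_6,x_7}\}$, then $\mathcal J_{x_1,x_2,\{x_3,x_4,x_5\},x_6,x_7}+\mathcal J_{x_1,x_2,x_5,\{x_3,x_4,x_6\},x_7}+\mathcal J_{x_1,x_2,x_5,x_6,\{x_3,x_4,x_7\}}$,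 then $\{x_5,x_6,\mathcal J_{x_1,x_2,x_3,x_4,x_7}\}$, then $\{x_5,\mathcal J_{x_1,x_2,x_3,x_4,x_6},x_7\}+\{\mathcal J_{x_1,x_2,x_3,x_4,x_5},x_6,x_7\}$; - first $\mathcal J_{x_1,x_2,x_3,x_4,\{x_5,x_6,x_7\}}$, then $\{x_3,x_4,\mathcal J_{x_1,x_2,x_5,x_6,x_7}\}$, then $\mathcal J_{\{x_1,x_2,x_3\},x_4,x_5,x_6,x_7}+\mathcal J_{x_3,\{x_1,x_2,x_4\},x_5,x_6,x_7}+\mathcal J_{x_3,x_4,\{x_1,x_2,x_5\},x_6,x_7}+\mathcal J_{x_3,x_4,x_5,\{x_1,x_2,x_6\},x_7}+\mathcal J_{x_3,x_4,x_5,x_6,\{x_1,x_2,x_7\}}$. A *homomorphism* $F:L\to L'$ is a linear functor $(F_0,F_1)$ with a trilinear natural transformation $F_2(x,y,z):\{F_0x,F_0y,F_0z\}\to F_0\{x,y,z\}$ such that $F_2(x,x,y)=0$, $F_2(x,y,z)+F_2(y,z,x)+F_2(z,x,y)=0$, and the following two composites agree: - $\mathcal J_{F_0x_1,\dots,F_0x_5}$,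 then $\{F_2(x_1,x_2,x_3),F_0x_4,F_0x_5\}+\{F_0x_3,F_2(x_1,x_2,x_4),F_0x_5\}+\{F_0x_3,F_0x_4,F_2(x_1,x_2,x_5)\}$, then $F_2(\{x_1,x_2,x_3\},x_4,x_5)+F_2(x_3,\{x_1,x_2,x_4\},x_5)+F_2(x_3,x_4,\{x_1,x_2,x_5\})$; - $\{F_0x_1,F_0x_2,F_2(x_3,x_4,x_5)\}$, then $F_2(x_1,x_2,\{x_3,x_4,x_5\})$, then $F_1\mathcal J_{x_1,\dots,x_5}$. The composite of $F$ followed by $G$ is $(G_0F_0,G_1F_1)$ with $(GF)_2(x,y,z)$ equal to $G_2(F_0x,F_0y,F_0z)$ followed by $G_1F_2(x,y,z)$; the identity has $F_2(x,y,z)=1_{\{x,y,z\}}$. A *2-homomorphism* $\theta:F\Rightarrow G$ is a linear natural transformation such that $F_2(x,y,z)$ followed by $\theta_{\{x,y,z\}}$ equals $\{\theta_x,\theta_y,\theta_z\}$ followed by $G_2(x,y,z)$. Vertical and horizontal composition are those of natural transformations. **Theorem.** With these compositions, 2-term homotopy Lie triple systems, their homomorphisms and 2-homomorphisms form a (strict)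 2-category $\mathbf{2HLTS}$, and Lie triple 2-systems, their homomorphisms and 2-homomorphisms form a (strict) 2-category $\mathbf{LT2}$. There are strict 2-functors $T:\mathbf{2HLTS}\to\mathbf{LT2}$ and $S:\mathbf{LT2}\to\mathbf{2HLTS}$, given by the formulas below, and 2-natural isomorphisms $TS\cong 1_{\mathbf{LT2}}$ and $ST\cong 1_{\mathbf{2HLTS}}$. In particular the two 2-categories are 2-equivalent. - $T(\mathcal T)$ has objects $T_0$ and morphisms $T_0\oplus T_{-1}$ with $s(x,f)=x$, $t(x,f)=x+df$, $1_x=(x,0)$, $(x,f)$ followed by $(x+df,g)$ equal to $(x,f+g)$; the bracket on objects is that of $T_0$, on morphisms $$\{(x,f),(y,g),(z,h)\}=\bigl([x,y,z],\,[x,y,h]+[x,g,z]+[f,y,z]+[df,g,z]+[df,y,h]+[x,dg,h]+[df,dg,h]\bigr),$$ and $\mathcal J_{x_1,\dots,x_5}=([x_1,x_2,[x_3,x_4,x_5]],J(x_1,\dots,x_5))$. Further $T(\varphi)_0=\varphi_0$, $T(\varphi)_1=\varphi_0\oplus\varphi_1$, $T(\varphi)_2(x,y,z)=([\varphi_0x,\varphi_0y,\varphi_0z],\varphi_2(x,y,z))$,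 and $T(\tau)_x=(\varphi_0x,\tau x)$ for $\tau:\varphi\Rightarrow\psi$. - $S(L)$ has $T_0=L_0$, $T_{-1}=\ker s$, $d=t|_{\ker s}$, bracket $\{\cdot,\cdot,\cdot\}$ on $L_0$, $[f,x,y]=\{f,1_x,1_y\}$, $[x,f,y]=\{1_x,f,1_y\}$, $[x,y,f]=\{1_x,1_y,f\}$, and $J(x_1,\dots,x_5)=\mathcal J_{x_1,\dots,x_5}-1_{s(\mathcal J_{x_1,\dots,x_5})}$. Further $S(F)_0=F_0$, $S(F)_1=F_1|_{\ker s}$, $S(F)_2(x,y,z)=F_2(x,y,z)-1_{s(F_2(x,y,z))}$, and $S(\theta)(x)=\theta_x-1_{s(\theta_x)}$. -/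

import Mathlib

open CategoryTheory Bicategory

universe w u

namespace LieTriple

/-! ### Curried multilinear maps -/

section Multilinear

variable {k : Type*} [CommSemiring k] {A B C D E M : Type*}
  [AddCommMonoid A] [AddCommMonoid B] [AddCommMonoid C] [AddCommMonoid D] [AddCommMonoid E]
  [AddCommMonoid M]
  [Module k A] [Module k B] [Module k C] [Module k D] [Module k E] [Module k M]

/-- A function of three variables that is linear in each of them, as a curried linear map. -/
def trilin (f : A → B → C → M)
    (a₁ : ∀ x x' y z, f (x + x') y z = f x y z + f x' y z)
    (s₁ : ∀ (c : k) x y z, f (c • x) y z = c • f x y z)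
    (a₂ : ∀ x y y' z, f x (y + y') z = f x y z + f x y' z)
    (s₂ : ∀ (c : k) x y z, f x (c • y) z = c • f x y z)
    (a₃ : ∀ x y z z', f x y (z + z') = f x y z + f x y z')
    (s₃ : ∀ (c : k) x y z, f x y (c • z) = c • f x y z) :
    A →ₗ[k] B →ₗ[k] C →ₗ[k] M :=
  LinearMap.mk₂ k
    (fun x y => { toFun := f x y, map_add' := a₃ x y, map_smul' := fun c z => s₃ c x y z })
    (fun x x' y => LinearMap.ext fun z => a₁ x x' y z)
    (fun c x y => LinearMap.ext fun z => s₁ c x y z)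
    (fun x y y' => LinearMap.ext fun z => a₂ x y y' z)
    (fun c x y => LinearMap.ext fun z => s₂ c x y z)

@[simp] theorem trilin_apply (f : A → B → C → M) (a₁ s₁ a₂ s₂ a₃ s₃) (x : A) (y : B) (z : C) :
    trilin (k := k) f a₁ s₁ a₂ s₂ a₃ s₃ x y z = f x y z := rfl

/-- A function of five variables that is linear in each of them, as a curried linear map. -/
def pentalin (f : A → B → C → D → E → M)
    (a₁ : ∀ x x' y z v w, f (x + x') y z v w = f x y z v w + f x' y z v w)
    (s₁ : ∀ (c : k) x y z v w, f (c • x) y z v w = c • f x y z v w)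
    (a₂ : ∀ x y y' z v w, f x (y + y') z v w = f x y z v w + f x y' z v w)
    (s₂ : ∀ (c : k) x y z v w, f x (c • y) z v w = c • f x y z v w)
    (a₃ : ∀ x y z z' v w, f x y (z + z') v w = f x y z v w + f x y z' v w)
    (s₃ : ∀ (c : k) x y z v w, f x y (c • z) v w = c • f x y z v w)
    (a₄ : ∀ x y z v v' w, f x y z (v + v') w = f x y z v w + f x y z v' w)
    (s₄ : ∀ (c : k) x y z v w, f x y z (c • v) w = c • f x y z v w)
    (a₅ : ∀ x y z v w w', f x y z v (w + w') = f x y z v w + f x y z v w')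
    (s₅ : ∀ (c : k) x y z v w, f x y z v (c • w) = c • f x y z v w) :
    A →ₗ[k] B →ₗ[k] C →ₗ[k] D →ₗ[k] E →ₗ[k] M :=
  LinearMap.mk₂ k
    (fun x y => trilin (f x y) (a₃ x y) (fun c => s₃ c x y) (a₄ x y) (fun c => s₄ c x y)
      (a₅ x y) (fun c => s₅ c x y))
    (fun x x' y => by ext z v w; exact a₁ x x' y z v w)
    (fun c x y => by ext z v w; exact s₁ c x y z v w)
    (fun x y y' => by ext z v w; exact a₂ x y y' z v w)
    (fun c x y => by ext z v w; exact s₂ c x y z v w)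

@[simp] theorem pentalin_apply (f : A → B → C → D → E → M) (a₁ s₁ a₂ s₂ a₃ s₃ a₄ s₄ a₅ s₅)
    (x : A) (y : B) (z : C) (v : D) (w : E) :
    pentalin (k := k) f a₁ s₁ a₂ s₂ a₃ s₃ a₄ s₄ a₅ s₅ x y z v w = f x y z v w := rfl

end Multilinear

/-! ### 2-term homotopy Lie triple systems -/

/-- The data of a 2-term homotopy Lie triple system: a complex `d : X₁ → X₀` (with `X₀` in degree
`0` and `X₁` in degree `-1`), the components of degree `0` and `-1` of a trilinear bracket of
degree `0`, and a 5-linear map `J`. -/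
structure HLTSData (k : Type w) [Field k] where
  X₀ : Type u
  X₁ : Type u
  [grp₀ : AddCommGroup X₀]
  [grp₁ : AddCommGroup X₁]
  [mod₀ : Module k X₀]
  [mod₁ : Module k X₁]
  /-- the differential -/
  d : X₁ →ₗ[k] X₀
  /-- `[x, y, z]` -/
  br : X₀ →ₗ[k] X₀ →ₗ[k] X₀ →ₗ[k] X₀
  /-- `[f, x, y]` -/
  brL : X₁ →ₗ[k] X₀ →ₗ[k] X₀ →ₗ[k] X₁
  /-- `[x, f, y]` -/
  brM : X₀ →ₗ[k] X₁ →ₗ[k] X₀ →ₗ[k] X₁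
  /-- `[x, y, f]` -/
  brR : X₀ →ₗ[k] X₀ →ₗ[k] X₁ →ₗ[k] X₁
  J : X₀ →ₗ[k] X₀ →ₗ[k] X₀ →ₗ[k] X₀ →ₗ[k] X₀ →ₗ[k] X₁

attribute [instance] HLTSData.grp₀ HLTSData.grp₁ HLTSData.mod₀ HLTSData.mod₁

/-- A 2-term homotopy Lie triple system over the field `k`. -/
structure HLTS (k : Type w) [Field k] extends HLTSData.{w, u} k where
  d_brR : ∀ x y f, d (brR x y f) = br x y (d f)
  d_brM : ∀ x f y, d (brM x f y) = br x (d f) y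
  brM_d : ∀ f g x, brM (d f) g x = brL f (d g) x
  brR_d : ∀ f x g, brR (d f) x g = brL f x (d g)
  br_skew : ∀ x y z, br x y z = -br y x z
  brR_skew : ∀ x y f, brR x y f = -brR y x f
  brM_skew : ∀ x f y, brM x f y = -brL f x y
  br_cyc : ∀ x y z, br x y z + br y z x + br z x y = 0
  brR_cyc : ∀ x y f, brR x y f + brM y f x + brL f x y = 0
  J_alt : ∀ x₁ x₂ x y, J x₁ x₂ x x y = 0
  J_cyc : ∀ x₁ x₂ x y z, J x₁ x₂ x y z + J x₁ x₂ y z x + J x₁ x₂ z x y = 0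
  d_J : ∀ x₁ x₂ x₃ x₄ x₅, d (J x₁ x₂ x₃ x₄ x₅) =
    -br x₁ x₂ (br x₃ x₄ x₅) + br x₃ (br x₁ x₂ x₄) x₅ + br (br x₁ x₂ x₃) x₄ x₅
      + br x₃ x₄ (br x₁ x₂ x₅)
  J_d₁ : ∀ f x₂ x₃ x₄ x₅, J (d f) x₂ x₃ x₄ x₅ =
    -brL f x₂ (br x₃ x₄ x₅) + brM x₃ (brL f x₂ x₄) x₅ + brL (brL f x₂ x₃) x₄ x₅
      + brR x₃ x₄ (brL f x₂ x₅)
  J_d₂ : ∀ x₁ f x₃ x₄ x₅, J x₁ (d f) x₃ x₄ x₅ =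
    -brM x₁ f (br x₃ x₄ x₅) + brM x₃ (brM x₁ f x₄) x₅ + brL (brM x₁ f x₃) x₄ x₅
      + brR x₃ x₄ (brM x₁ f x₅)
  J_d₃ : ∀ x₁ x₂ f x₄ x₅, J x₁ x₂ (d f) x₄ x₅ =
    -brR x₁ x₂ (brL f x₄ x₅) + brL f (br x₁ x₂ x₄) x₅ + brL (brR x₁ x₂ f) x₄ x₅
      + brL f x₄ (br x₁ x₂ x₅)
  J_d₅ : ∀ x₁ x₂ x₃ x₄ f, J x₁ x₂ x₃ x₄ (d f) =
    -brR x₁ x₂ (brR x₃ x₄ f) + brR x₃ (br x₁ x₂ x₄) f + brR (br x₁ x₂ x₃) x₄ f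
      + brR x₃ x₄ (brR x₁ x₂ f)
  J_coh : ∀ x₁ x₂ x₃ x₄ x₅ x₆ x₇,
    brL (J x₁ x₂ x₃ x₄ x₅) x₆ x₇ + brM x₅ (J x₁ x₂ x₃ x₄ x₆) x₇ + brR x₁ x₂ (J x₃ x₄ x₅ x₆ x₇)
      + brR x₅ x₆ (J x₁ x₂ x₃ x₄ x₇) + J x₁ x₂ (br x₃ x₄ x₅) x₆ x₇ + J x₁ x₂ x₅ (br x₃ x₄ x₆) x₇
      + J x₁ x₂ x₅ x₆ (br x₃ x₄ x₇) =
    brR x₃ x₄ (J x₁ x₂ x₅ x₆ x₇) + J (br x₁ x₂ x₃) x₄ x₅ x₆ x₇ + J x₃ (br x₁ x₂ x₄) x₅ x₆ x₇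
      + J x₃ x₄ (br x₁ x₂ x₅) x₆ x₇ + J x₃ x₄ x₅ (br x₁ x₂ x₆) x₇
      + J x₁ x₂ x₃ x₄ (br x₅ x₆ x₇) + J x₃ x₄ x₅ x₆ (br x₁ x₂ x₇)

namespace HLTS

variable {k : Type w} [Field k]

/-- The data of a homomorphism of 2-term homotopy Lie triple systems. -/
@[ext] structure HomData (A B : HLTSData.{w, u} k) where
  φ₀ : A.X₀ →ₗ[k] B.X₀
  φ₁ : A.X₁ →ₗ[k] B.X₁
  φ₂ : A.X₀ →ₗ[k] A.X₀ →ₗ[k] A.X₀ →ₗ[k] B.X₁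

/-- A homomorphism of 2-term homotopy Lie triple systems. -/
@[ext] structure Hom (A B : HLTS.{w, u} k) extends HomData A.toHLTSData B.toHLTSData where
  chain : ∀ h, φ₀ (A.d h) = B.d (φ₁ h)
  alt : ∀ x y, φ₂ x x y = 0
  cyc : ∀ x y z, φ₂ x y z = -φ₂ y z x - φ₂ z x y
  d_φ₂ : ∀ x y z, B.d (φ₂ x y z) = φ₀ (A.br x y z) - B.br (φ₀ x) (φ₀ y) (φ₀ z)
  φ₂_R : ∀ x y h, φ₂ x y (A.d h) = φ₁ (A.brR x y h) - B.brR (φ₀ x) (φ₀ y) (φ₁ h)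
  φ₂_M : ∀ x h y, φ₂ x (A.d h) y = φ₁ (A.brM x h y) - B.brM (φ₀ x) (φ₁ h) (φ₀ y)
  coh : ∀ x₁ x₂ x₃ x₄ x₅,
    B.J (φ₀ x₁) (φ₀ x₂) (φ₀ x₃) (φ₀ x₄) (φ₀ x₅) + B.brL (φ₂ x₁ x₂ x₃) (φ₀ x₄) (φ₀ x₅)
      + B.brM (φ₀ x₃) (φ₂ x₁ x₂ x₄) (φ₀ x₅) + B.brR (φ₀ x₃) (φ₀ x₄) (φ₂ x₁ x₂ x₅)
      + φ₂ (A.br x₁ x₂ x₃) x₄ x₅ + φ₂ x₃ (A.br x₁ x₂ x₄) x₅ + φ₂ x₃ x₄ (A.br x₁ x₂ x₅) =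
    B.brR (φ₀ x₁) (φ₀ x₂) (φ₂ x₃ x₄ x₅) + φ₂ x₁ x₂ (A.br x₃ x₄ x₅) + φ₁ (A.J x₁ x₂ x₃ x₄ x₅)

/-- A 2-homomorphism `φ ⇒ ψ`: a chain homotopy `τ` from `φ` to `ψ`, compatible with `φ₂`, `ψ₂`. -/
@[ext] structure TwoHom {A B : HLTS.{w, u} k} (φ ψ : Hom A B) where
  τ : A.X₀ →ₗ[k] B.X₁
  d_τ : ∀ x, B.d (τ x) = ψ.φ₀ x - φ.φ₀ x
  τ_d : ∀ h, τ (A.d h) = ψ.φ₁ h - φ.φ₁ h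
  coh : ∀ x y z, φ.φ₂ x y z - ψ.φ₂ x y z =
    B.brR (φ.φ₀ x) (φ.φ₀ y) (τ z) + B.brM (φ.φ₀ x) (τ y) (φ.φ₀ z) + B.brL (τ x) (φ.φ₀ y) (φ.φ₀ z)
      + B.brM (B.d (τ x)) (τ y) (φ.φ₀ z) + B.brR (B.d (τ x)) (φ.φ₀ y) (τ z)
      + B.brR (φ.φ₀ x) (B.d (τ y)) (τ z)
      + B.brR (B.d (τ x)) (B.d (τ y)) (τ z)
      - τ (A.br x y z)

section Lemmas

variable (A : HLTS.{w, u} k)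

theorem d_brL (f x y) : A.d (A.brL f x y) = A.br (A.d f) x y := by
  have h := A.brM_skew x f y
  rw [← neg_eq_iff_eq_neg] at h
  rw [← h, map_neg, A.d_brM, A.br_skew (A.d f)]

theorem brM_dR (x f g) : A.brM x f (A.d g) = A.brR x (A.d f) g := by
  rw [A.brM_skew, ← A.brR_d, A.brR_skew, neg_neg]

variable {A} {B : HLTS.{w, u} k}

theorem Hom.skew (φ : Hom A B) (x y z) : φ.φ₂ x y z = -φ.φ₂ y x z := by
  have h := φ.alt (x + y) z
  simp only [map_add, LinearMap.add_apply, φ.alt, zero_add, add_zero] at h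
  exact eq_neg_of_add_eq_zero_right h

theorem Hom.φ₂_L (φ : Hom A B) (h x y) :
    φ.φ₂ (A.d h) x y = φ.φ₁ (A.brL h x y) - B.brL (φ.φ₁ h) (φ.φ₀ x) (φ.φ₀ y) := by
  rw [φ.skew, φ.φ₂_M, A.brM_skew, B.brM_skew, map_neg]
  abel

end Lemmas

/-- The identity homomorphism. -/
def Hom.id (A : HLTS.{w, u} k) : Hom A A where
  φ₀ := LinearMap.id
  φ₁ := LinearMap.id
  φ₂ := 0
  chain _ := rfl
  alt := by simp
  cyc := by simp
  d_φ₂ := by simp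
  φ₂_R := by simp
  φ₂_M := by simp
  coh := by simp

/-- The composite of `φ` followed by `ψ`. -/
def Hom.comp {A B C : HLTS.{w, u} k} (φ : Hom A B) (ψ : Hom B C) : Hom A C where
  φ₀ := ψ.φ₀ ∘ₗ φ.φ₀
  φ₁ := ψ.φ₁ ∘ₗ φ.φ₁
  φ₂ := trilin (fun x y z => ψ.φ₂ (φ.φ₀ x) (φ.φ₀ y) (φ.φ₀ z) + ψ.φ₁ (φ.φ₂ x y z))
    (by intros; simp; abel) (by intros; simp)
    (by intros; simp; abel) (by intros; simp) (by intros; simp; abel) (by intros; simp)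
  chain h := by simp [φ.chain, ψ.chain]
  alt := by simp [φ.alt, ψ.alt]
  cyc x y z := by
    simp only [trilin_apply]
    rw [φ.cyc x y z, ψ.cyc (φ.φ₀ x) (φ.φ₀ y) (φ.φ₀ z)]
    simp only [map_sub, map_neg]
    abel
  d_φ₂ x y z := by
    simp only [trilin_apply, map_add, ψ.d_φ₂, ← ψ.chain, φ.d_φ₂, map_sub, LinearMap.comp_apply]
    abel
  φ₂_R x y h := by
    simp only [trilin_apply, φ.chain, ψ.φ₂_R, φ.φ₂_R, map_sub, LinearMap.comp_apply]
    abel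
  φ₂_M x h y := by
    simp only [trilin_apply, φ.chain, ψ.φ₂_M, φ.φ₂_M, map_sub, LinearMap.comp_apply]
    abel
  coh x₁ x₂ x₃ x₄ x₅ := by
    have hφ := congrArg ψ.φ₁ (φ.coh x₁ x₂ x₃ x₄ x₅)
    have hψ := ψ.coh (φ.φ₀ x₁) (φ.φ₀ x₂) (φ.φ₀ x₃) (φ.φ₀ x₄) (φ.φ₀ x₅)
    have h₁ := ψ.φ₂_L (φ.φ₂ x₁ x₂ x₃) (φ.φ₀ x₄) (φ.φ₀ x₅)
    have h₂ := ψ.φ₂_M (φ.φ₀ x₃) (φ.φ₂ x₁ x₂ x₄) (φ.φ₀ x₅)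
    have h₃ := ψ.φ₂_R (φ.φ₀ x₃) (φ.φ₀ x₄) (φ.φ₂ x₁ x₂ x₅)
    have h₄ := ψ.φ₂_R (φ.φ₀ x₁) (φ.φ₀ x₂) (φ.φ₂ x₃ x₄ x₅)
    simp only [trilin_apply, map_add, map_sub, LinearMap.add_apply, LinearMap.sub_apply,
      φ.d_φ₂, LinearMap.comp_apply] at *
    linear_combination (norm := abel) hφ + hψ + h₁ + h₂ + h₃ - h₄

/-- The identity 2-homomorphism. -/
def TwoHom.id {A B : HLTS.{w, u} k} (φ : Hom A B) : TwoHom φ φ where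
  τ := 0
  d_τ := by simp
  τ_d := by simp
  coh := by simp

/-- Vertical composition of 2-homomorphisms. -/
def TwoHom.vcomp {A B : HLTS.{w, u} k} {φ ψ χ : Hom A B} (σ : TwoHom φ ψ) (τ : TwoHom ψ χ) :
    TwoHom φ χ where
  τ := σ.τ + τ.τ
  d_τ x := by simp [σ.d_τ, τ.d_τ]
  τ_d h := by simp [σ.τ_d, τ.τ_d]
  coh x y z := by
    have hψ : ∀ x, ψ.φ₀ x = φ.φ₀ x + B.d (σ.τ x) := fun x => by rw [σ.d_τ]; abel
    have h₁ := σ.coh x y z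
    have h₂ := τ.coh x y z
    simp only [hψ, map_add, LinearMap.add_apply, B.brM_d, B.brM_dR, B.brR_d] at h₁ h₂ ⊢
    linear_combination (norm := abel) h₁ + h₂

/-- Whiskering `φ` followed by `σ`. -/
def TwoHom.whiskerLeft {A B C : HLTS.{w, u} k} (φ : Hom A B) {ψ χ : Hom B C} (σ : TwoHom ψ χ) :
    TwoHom (φ.comp ψ) (φ.comp χ) where
  τ := σ.τ ∘ₗ φ.φ₀
  d_τ x := by simp [σ.d_τ, Hom.comp]
  τ_d h := by simp [σ.τ_d, Hom.comp, φ.chain]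
  coh x y z := by
    have h₁ := σ.coh (φ.φ₀ x) (φ.φ₀ y) (φ.φ₀ z)
    have h₂ := σ.τ_d (φ.φ₂ x y z)
    simp only [Hom.comp, trilin_apply, LinearMap.comp_apply, φ.d_φ₂, map_sub] at *
    linear_combination (norm := abel) h₁ + h₂

/-- Whiskering `σ` followed by `χ`. -/
def TwoHom.whiskerRight {A B C : HLTS.{w, u} k} {φ ψ : Hom A B} (σ : TwoHom φ ψ) (χ : Hom B C) :
    TwoHom (φ.comp χ) (ψ.comp χ) where
  τ := χ.φ₁ ∘ₗ σ.τ
  d_τ x := by simp [σ.d_τ, Hom.comp, ← χ.chain]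
  τ_d h := by simp [σ.τ_d, Hom.comp]
  coh x y z := by
    have hψ : ∀ x, ψ.φ₀ x = φ.φ₀ x + B.d (σ.τ x) := fun x => by rw [σ.d_τ]; abel
    have h₁ := congrArg χ.φ₁ (σ.coh x y z)
    simp only [Hom.comp, trilin_apply, LinearMap.comp_apply, map_sub, map_add,
      LinearMap.add_apply, hψ, χ.φ₂_L, χ.φ₂_M, χ.φ₂_R, χ.chain, B.brM_d, B.brM_dR, B.brR_d,
      C.brM_d, C.brM_dR, C.brR_d] at h₁ ⊢
    linear_combination (norm := abel) h₁

instance (A B : HLTS.{w, u} k) : Category (Hom A B) where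
  Hom := TwoHom
  id := TwoHom.id
  comp := TwoHom.vcomp
  id_comp σ := TwoHom.ext (by simp [TwoHom.vcomp, TwoHom.id])
  comp_id σ := TwoHom.ext (by simp [TwoHom.vcomp, TwoHom.id])
  assoc σ τ υ := TwoHom.ext (by simp [TwoHom.vcomp, add_assoc])


theorem Hom.ext_data {A B : HLTS.{w, u} k} {φ ψ : Hom A B} (h : φ.toHomData = ψ.toHomData) :
    φ = ψ := by
  cases φ; cases ψ; cases h; rfl

theorem Hom.id_comp {A B : HLTS.{w, u} k} (φ : Hom A B) : (Hom.id A).comp φ = φ :=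
  Hom.ext_data (HomData.ext rfl rfl (by ext; simp [Hom.comp, Hom.id]))

theorem Hom.comp_id {A B : HLTS.{w, u} k} (φ : Hom A B) : φ.comp (Hom.id B) = φ :=
  Hom.ext_data (HomData.ext rfl rfl (by ext; simp [Hom.comp, Hom.id]))

theorem Hom.assoc {A B C D : HLTS.{w, u} k} (φ : Hom A B) (ψ : Hom B C) (χ : Hom C D) :
    (φ.comp ψ).comp χ = φ.comp (ψ.comp χ) :=
  Hom.ext_data (HomData.ext rfl rfl (by ext; simp [Hom.comp, add_assoc]))

theorem id_τ {A B : HLTS.{w, u} k} (φ : Hom A B) : TwoHom.τ (𝟙 φ) = 0 := rfl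

theorem comp_τ {A B : HLTS.{w, u} k} {φ ψ χ : Hom A B} (σ : φ ⟶ ψ) (τ : ψ ⟶ χ) :
    TwoHom.τ (σ ≫ τ) = TwoHom.τ σ + TwoHom.τ τ := rfl

theorem eqToHom_τ {A B : HLTS.{w, u} k} {φ ψ : Hom A B} (h : φ = ψ) :
    TwoHom.τ (eqToHom h) = 0 := by
  subst h; rfl

theorem twoHom_ext {A B : HLTS.{w, u} k} {φ ψ : Hom A B} {σ τ : φ ⟶ ψ}
    (h : TwoHom.τ σ = TwoHom.τ τ) : σ = τ :=
  TwoHom.ext h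

/-- The invertible 2-homomorphism between equal homomorphisms, given by the zero homotopy. -/
def zeroIso {A B : HLTS.{w, u} k} {φ ψ : Hom A B} (h : φ = ψ) : φ ≅ ψ where
  hom := { τ := 0, d_τ := by simp [h], τ_d := by simp [h], coh := by simp [h] }
  inv := { τ := 0, d_τ := by simp [h], τ_d := by simp [h], coh := by simp [h] }
  hom_inv_id := twoHom_ext (add_zero (0 : A.X₀ →ₗ[k] B.X₁))
  inv_hom_id := twoHom_ext (add_zero (0 : A.X₀ →ₗ[k] B.X₁))

theorem zeroIso_eq {A B : HLTS.{w, u} k} {φ ψ : Hom A B} (h : φ = ψ) : zeroIso h = eqToIso h := by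
  ext : 1
  exact twoHom_ext (eqToHom_τ h).symm

/-- The 2-category of 2-term homotopy Lie triple systems. -/
instance : Bicategory (HLTS.{w, u} k) where
  Hom := Hom
  id := Hom.id
  comp := Hom.comp
  homCategory := inferInstance
  whiskerLeft φ _ _ σ := TwoHom.whiskerLeft φ σ
  whiskerRight σ χ := TwoHom.whiskerRight σ χ
  associator φ ψ χ := zeroIso (Hom.assoc φ ψ χ)
  leftUnitor φ := zeroIso (Hom.id_comp φ)
  rightUnitor φ := zeroIso (Hom.comp_id φ)
  whiskerLeft_id _ _ := twoHom_ext rfl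
  whiskerLeft_comp _ _ _ _ _ _ := twoHom_ext rfl
  id_whiskerLeft σ := twoHom_ext (by simp : σ.τ = 0 + (σ.τ + 0))
  comp_whiskerLeft φ ψ _ _ σ := twoHom_ext
    (by simp : σ.τ ∘ₗ ψ.φ₀ ∘ₗ φ.φ₀ = 0 + (σ.τ ∘ₗ ψ.φ₀ ∘ₗ φ.φ₀ + 0))
  id_whiskerRight _ ψ := twoHom_ext (LinearMap.comp_zero ψ.φ₁)
  comp_whiskerRight σ τ χ := twoHom_ext (LinearMap.comp_add σ.τ τ.τ χ.φ₁)
  whiskerRight_id σ := twoHom_ext (by simp : σ.τ = 0 + (σ.τ + 0))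
  whiskerRight_comp σ ψ χ := twoHom_ext
    (by simp : χ.φ₁ ∘ₗ ψ.φ₁ ∘ₗ σ.τ = 0 + (χ.φ₁ ∘ₗ ψ.φ₁ ∘ₗ σ.τ + 0))
  whisker_assoc φ _ _ σ χ := twoHom_ext
    (by simp : χ.φ₁ ∘ₗ σ.τ ∘ₗ φ.φ₀ = 0 + (χ.φ₁ ∘ₗ σ.τ ∘ₗ φ.φ₀ + 0))
  whisker_exchange {A B C φ ψ χ ω} σ τ := by
    apply twoHom_ext
    ext x
    have h := TwoHom.τ_d τ (TwoHom.τ σ x)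
    rw [TwoHom.d_τ σ, map_sub] at h
    simp only [comp_τ, TwoHom.whiskerRight, TwoHom.whiskerLeft, LinearMap.add_apply,
      LinearMap.comp_apply]
    linear_combination (norm := abel) -h
  pentagon {A B C D E} φ ψ χ ω := twoHom_ext
    (by simp : ω.φ₁ ∘ₗ (0 : A.X₀ →ₗ[k] D.X₁) + (0 + (0 : B.X₀ →ₗ[k] E.X₁) ∘ₗ φ.φ₀) = 0 + 0)
  triangle {A B C} φ ψ := twoHom_ext
    (by simp : 0 + (0 : B.X₀ →ₗ[k] C.X₁) ∘ₗ φ.φ₀ = ψ.φ₁ ∘ₗ (0 : A.X₀ →ₗ[k] B.X₁))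

instance : Bicategory.Strict (HLTS.{w, u} k) where
  id_comp := Hom.id_comp
  comp_id := Hom.comp_id
  assoc := Hom.assoc
  leftUnitor_eqToIso _ := zeroIso_eq _
  rightUnitor_eqToIso _ := zeroIso_eq _
  associator_eqToIso _ _ _ := zeroIso_eq _

end HLTS

/-! ### 2-vector spaces -/

/-- The space of composable pairs of arrows, for given source and target maps. -/
def composable {k M O : Type*} [Field k] [AddCommGroup M] [AddCommGroup O] [Module k M]
    [Module k O] (s t : M →ₗ[k] O) : Submodule k (M × M) :=
  LinearMap.eqLocus (t ∘ₗ LinearMap.fst k M M) (s ∘ₗ LinearMap.snd k M M)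

/-- A 2-vector space: a category internal to vector spaces over `k`. -/
structure TwoVect (k : Type w) [Field k] where
  /-- objects -/
  Ob : Type u
  /-- morphisms -/
  Mor : Type u
  [grpOb : AddCommGroup Ob]
  [grpMor : AddCommGroup Mor]
  [modOb : Module k Ob]
  [modMor : Module k Mor]
  /-- source -/
  s : Mor →ₗ[k] Ob
  /-- target -/
  t : Mor →ₗ[k] Ob
  /-- identities -/
  one : Ob →ₗ[k] Mor
  /-- composition of `f` followed by `g`, for `t f = s g` -/
  comp : composable s t →ₗ[k] Mor
  s_one : ∀ x, s (one x) = x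
  t_one : ∀ x, t (one x) = x
  s_comp : ∀ (f g : Mor) (h : t f = s g), s (comp ⟨(f, g), h⟩) = s f
  t_comp : ∀ (f g : Mor) (h : t f = s g), t (comp ⟨(f, g), h⟩) = t g
  one_comp : ∀ f, comp ⟨(one (s f), f), t_one (s f)⟩ = f
  comp_one : ∀ f, comp ⟨(f, one (t f)), (s_one (t f)).symm⟩ = f
  assoc : ∀ (f g h : Mor) (hfg : t f = s g) (hgh : t g = s h),
    comp ⟨(comp ⟨(f, g), hfg⟩, h), (t_comp f g hfg).trans hgh⟩ =
      comp ⟨(f, comp ⟨(g, h), hgh⟩), hfg.trans (s_comp g h hgh).symm⟩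

attribute [instance] TwoVect.grpOb TwoVect.grpMor TwoVect.modOb TwoVect.modMor

namespace TwoVect

variable {k : Type w} [Field k] (V : TwoVect.{w, u} k)

/-- The composite of `f` followed by `g`. -/
def cmp (f g : V.Mor) (h : V.t f = V.s g) : V.Mor := V.comp ⟨(f, g), h⟩

/-- `m` is the composite of the given nonempty path of composable morphisms, first arrow first. -/
def IsComposite : List V.Mor → V.Mor → Prop
  | [], _ => False
  | [f], m => f = m
  | f :: g :: l, m => ∃ n, IsComposite (g :: l) n ∧ ∃ h : V.t f = V.s n, V.cmp f n h = m

/-- Both paths are composable and they have the same composite. -/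
def Commutes (p q : List V.Mor) : Prop := ∃ m, V.IsComposite p m ∧ V.IsComposite q m

/-- `f` is an isomorphism. -/
def IsIso (f : V.Mor) : Prop :=
  ∃ g, V.Commutes [f, g] [V.one (V.s f)] ∧ V.Commutes [g, f] [V.one (V.t f)]

/-- The composition is determined by the remaining structure. -/
theorem cmp_eq (f g : V.Mor) (h : V.t f = V.s g) : V.cmp f g h = f + g - V.one (V.t f) := by
  have e : V.s (g - V.one (V.t f)) = 0 := by rw [map_sub, V.s_one, h, sub_self]
  have h₂ := V.one_comp (g - V.one (V.t f))
  have key : (⟨(f, g), h⟩ : composable V.s V.t) =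
      ⟨(f, V.one (V.t f)), (V.s_one (V.t f)).symm⟩ +
      ⟨(V.one (V.s (g - V.one (V.t f))), g - V.one (V.t f)), V.t_one _⟩ := by
    apply Subtype.ext
    simp [e]
  rw [cmp, key, map_add, V.comp_one, h₂]
  abel

theorem isComposite_two (f g m : V.Mor) :
    V.IsComposite [f, g] m ↔ V.t f = V.s g ∧ f + g - V.one (V.t f) = m := by
  simp [IsComposite, cmp_eq]

theorem isComposite_three (f g h m : V.Mor) : V.IsComposite [f, g, h] m ↔
    V.t f = V.s g ∧ V.t g = V.s h ∧ f + (g + h - V.one (V.t g)) - V.one (V.t f) = m := by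
  rw [IsComposite]
  simp only [isComposite_two, cmp_eq, exists_prop]
  constructor
  · rintro ⟨_, ⟨h₁, rfl⟩, h₂, rfl⟩
    refine ⟨?_, h₁, rfl⟩
    simpa [V.s_one, h₁] using h₂
  · rintro ⟨h₁, h₂, rfl⟩
    exact ⟨_, ⟨h₂, rfl⟩, by simp [V.s_one, h₁, h₂], rfl⟩

theorem commutes₂₁ (f g h : V.Mor) :
    V.Commutes [f, g] [h] ↔ V.t f = V.s g ∧ f + g - V.one (V.t f) = h := by
  simp [Commutes, IsComposite, cmp_eq]

theorem commutes₂₂ (f g f' g' : V.Mor) : V.Commutes [f, g] [f', g'] ↔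
    V.t f = V.s g ∧ V.t f' = V.s g' ∧ f + g - V.one (V.t f) = f' + g' - V.one (V.t f') := by
  simp only [Commutes, isComposite_two]
  constructor
  · rintro ⟨m, ⟨h₁, h₂⟩, h₃, h₄⟩
    exact ⟨h₁, h₃, h₂.trans h₄.symm⟩
  · rintro ⟨h₁, h₂, h₃⟩
    exact ⟨_, ⟨h₁, rfl⟩, h₂, h₃.symm⟩

theorem commutes₃₃ (f g h f' g' h' : V.Mor) : V.Commutes [f, g, h] [f', g', h'] ↔
    (V.t f = V.s g ∧ V.t g = V.s h) ∧ (V.t f' = V.s g' ∧ V.t g' = V.s h') ∧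
      f + (g + h - V.one (V.t g)) - V.one (V.t f) =
        f' + (g' + h' - V.one (V.t g')) - V.one (V.t f') := by
  simp only [Commutes, isComposite_three]
  constructor
  · rintro ⟨m, ⟨h₁, h₁', h₂⟩, h₃, h₃', h₄⟩
    exact ⟨⟨h₁, h₁'⟩, ⟨h₃, h₃'⟩, h₂.trans h₄.symm⟩
  · rintro ⟨⟨h₁, h₁'⟩, ⟨h₂, h₂'⟩, h₃⟩
    exact ⟨_, ⟨h₁, h₁', rfl⟩, h₂, h₂', h₃.symm⟩

/-- Every morphism of a 2-vector space is invertible. -/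
theorem isIso (f : V.Mor) : V.IsIso f := by
  refine ⟨V.one (V.s f) + V.one (V.t f) - f, ?_, ?_⟩ <;> rw [commutes₂₁] <;>
    simp [V.s_one, V.t_one]

end TwoVect

/-! ### Lie triple 2-systems -/

/-- The data of a Lie triple 2-system: a 2-vector space, a trilinear bracket on objects and on
morphisms, and the fundamentor. -/
structure LT2Data (k : Type w) [Field k] extends TwoVect.{w, u} k where
  br₀ : Ob →ₗ[k] Ob →ₗ[k] Ob →ₗ[k] Ob
  br₁ : Mor →ₗ[k] Mor →ₗ[k] Mor →ₗ[k] Mor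
  Jac : Ob →ₗ[k] Ob →ₗ[k] Ob →ₗ[k] Ob →ₗ[k] Ob →ₗ[k] Mor

/-- A Lie triple 2-system over the field `k`. -/
structure LT2 (k : Type w) [Field k] extends LT2Data.{w, u} k where
  -- the bracket is a functor
  s_br : ∀ f g h, s (br₁ f g h) = br₀ (s f) (s g) (s h)
  t_br : ∀ f g h, t (br₁ f g h) = br₀ (t f) (t g) (t h)
  br_one : ∀ x y z, br₁ (one x) (one y) (one z) = one (br₀ x y z)
  br_comp : ∀ (f f' g g' h h' : Mor) (hf : t f = s f') (hg : t g = s g') (hh : t h = s h'),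
    toTwoVect.Commutes [br₁ f g h, br₁ f' g' h']
      [br₁ (toTwoVect.cmp f f' hf) (toTwoVect.cmp g g' hg) (toTwoVect.cmp h h' hh)]
  -- its symmetries, on objects and on morphisms
  br₀_alt : ∀ x y, br₀ x x y = 0
  br₀_cyc : ∀ x y z, br₀ x y z + br₀ y z x + br₀ z x y = 0
  br₁_alt : ∀ f g, br₁ f f g = 0
  br₁_cyc : ∀ f g h, br₁ f g h + br₁ g h f + br₁ h f g = 0
  -- the fundamentor is a natural isomorphism
  s_Jac : ∀ x₁ x₂ x₃ x₄ x₅, s (Jac x₁ x₂ x₃ x₄ x₅) = br₀ x₁ x₂ (br₀ x₃ x₄ x₅)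
  t_Jac : ∀ x₁ x₂ x₃ x₄ x₅, t (Jac x₁ x₂ x₃ x₄ x₅) =
    br₀ (br₀ x₁ x₂ x₃) x₄ x₅ + br₀ x₃ (br₀ x₁ x₂ x₄) x₅ + br₀ x₃ x₄ (br₀ x₁ x₂ x₅)
  Jac_iso : ∀ x₁ x₂ x₃ x₄ x₅, toTwoVect.IsIso (Jac x₁ x₂ x₃ x₄ x₅)
  Jac_nat : ∀ f₁ f₂ f₃ f₄ f₅ : Mor, toTwoVect.Commutes
    [br₁ f₁ f₂ (br₁ f₃ f₄ f₅), Jac (t f₁) (t f₂) (t f₃) (t f₄) (t f₅)]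
    [Jac (s f₁) (s f₂) (s f₃) (s f₄) (s f₅),
      br₁ (br₁ f₁ f₂ f₃) f₄ f₅ + br₁ f₃ (br₁ f₁ f₂ f₄) f₅ + br₁ f₃ f₄ (br₁ f₁ f₂ f₅)]
  -- it has the symmetries of the bracket in its last three arguments
  Jac_alt : ∀ x₁ x₂ x y, Jac x₁ x₂ x x y = 0
  Jac_cyc : ∀ x₁ x₂ x y z, Jac x₁ x₂ x y z + Jac x₁ x₂ y z x + Jac x₁ x₂ z x y = 0
  -- the fundamental identity; `one` of a sum is the identity on the summands that do not change
  Jac_coh : ∀ x₁ x₂ x₃ x₄ x₅ x₆ x₇, toTwoVect.Commutes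
    [br₁ (one x₁) (one x₂) (Jac x₃ x₄ x₅ x₆ x₇),
     Jac x₁ x₂ (br₀ x₃ x₄ x₅) x₆ x₇ + Jac x₁ x₂ x₅ (br₀ x₃ x₄ x₆) x₇
      + Jac x₁ x₂ x₅ x₆ (br₀ x₃ x₄ x₇),
     br₁ (one x₅) (one x₆) (Jac x₁ x₂ x₃ x₄ x₇)
      + one (br₀ (br₀ x₁ x₂ (br₀ x₃ x₄ x₅)) x₆ x₇ + br₀ (br₀ x₃ x₄ x₅) (br₀ x₁ x₂ x₆) x₇
        + br₀ (br₀ x₃ x₄ x₅) x₆ (br₀ x₁ x₂ x₇) + br₀ (br₀ x₁ x₂ x₅) (br₀ x₃ x₄ x₆) x₇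
        + br₀ x₅ (br₀ x₁ x₂ (br₀ x₃ x₄ x₆)) x₇ + br₀ x₅ (br₀ x₃ x₄ x₆) (br₀ x₁ x₂ x₇)
        + br₀ (br₀ x₁ x₂ x₅) x₆ (br₀ x₃ x₄ x₇) + br₀ x₅ (br₀ x₁ x₂ x₆) (br₀ x₃ x₄ x₇)),
     br₁ (one x₅) (Jac x₁ x₂ x₃ x₄ x₆) (one x₇) + br₁ (Jac x₁ x₂ x₃ x₄ x₅) (one x₆) (one x₇)
      + one (br₀ (br₀ x₃ x₄ x₅) (br₀ x₁ x₂ x₆) x₇ + br₀ (br₀ x₃ x₄ x₅) x₆ (br₀ x₁ x₂ x₇)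
        + br₀ (br₀ x₁ x₂ x₅) (br₀ x₃ x₄ x₆) x₇ + br₀ x₅ (br₀ x₃ x₄ x₆) (br₀ x₁ x₂ x₇)
        + br₀ (br₀ x₁ x₂ x₅) x₆ (br₀ x₃ x₄ x₇) + br₀ x₅ (br₀ x₁ x₂ x₆) (br₀ x₃ x₄ x₇)
        + br₀ x₅ x₆ (br₀ (br₀ x₁ x₂ x₃) x₄ x₇) + br₀ x₅ x₆ (br₀ x₃ (br₀ x₁ x₂ x₄) x₇)
        + br₀ x₅ x₆ (br₀ x₃ x₄ (br₀ x₁ x₂ x₇)))]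
    [Jac x₁ x₂ x₃ x₄ (br₀ x₅ x₆ x₇),
     br₁ (one x₃) (one x₄) (Jac x₁ x₂ x₅ x₆ x₇)
      + one (br₀ (br₀ x₁ x₂ x₃) x₄ (br₀ x₅ x₆ x₇) + br₀ x₃ (br₀ x₁ x₂ x₄) (br₀ x₅ x₆ x₇)),
     Jac (br₀ x₁ x₂ x₃) x₄ x₅ x₆ x₇ + Jac x₃ (br₀ x₁ x₂ x₄) x₅ x₆ x₇
      + Jac x₃ x₄ (br₀ x₁ x₂ x₅) x₆ x₇ + Jac x₃ x₄ x₅ (br₀ x₁ x₂ x₆) x₇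
      + Jac x₃ x₄ x₅ x₆ (br₀ x₁ x₂ x₇)]

namespace LT2

variable {k : Type w} [Field k]

/-- The data of a homomorphism of Lie triple 2-systems. -/
@[ext] structure HomData (A B : LT2Data.{w, u} k) where
  F₀ : A.Ob →ₗ[k] B.Ob
  F₁ : A.Mor →ₗ[k] B.Mor
  F₂ : A.Ob →ₗ[k] A.Ob →ₗ[k] A.Ob →ₗ[k] B.Mor

/-- A homomorphism of Lie triple 2-systems. -/
structure Hom (A B : LT2.{w, u} k) extends HomData A.toLT2Data B.toLT2Data where
  -- `(F₀, F₁)` is a functor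
  s_F₁ : ∀ f, B.s (F₁ f) = F₀ (A.s f)
  t_F₁ : ∀ f, B.t (F₁ f) = F₀ (A.t f)
  F₁_one : ∀ x, F₁ (A.one x) = B.one (F₀ x)
  F₁_comp : ∀ (f g : A.Mor) (h : A.t f = A.s g), B.Commutes [F₁ f, F₁ g] [F₁ (A.cmp f g h)]
  -- `F₂` is a natural transformation
  s_F₂ : ∀ x y z, B.s (F₂ x y z) = B.br₀ (F₀ x) (F₀ y) (F₀ z)
  t_F₂ : ∀ x y z, B.t (F₂ x y z) = F₀ (A.br₀ x y z)
  F₂_nat : ∀ f g h, B.Commutes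
    [B.br₁ (F₁ f) (F₁ g) (F₁ h), F₂ (A.t f) (A.t g) (A.t h)]
    [F₂ (A.s f) (A.s g) (A.s h), F₁ (A.br₁ f g h)]
  alt : ∀ x y, F₂ x x y = 0
  cyc : ∀ x y z, F₂ x y z = -F₂ y z x - F₂ z x y
  coh : ∀ x₁ x₂ x₃ x₄ x₅, B.Commutes
    [B.Jac (F₀ x₁) (F₀ x₂) (F₀ x₃) (F₀ x₄) (F₀ x₅),
     B.br₁ (F₂ x₁ x₂ x₃) (B.one (F₀ x₄)) (B.one (F₀ x₅))
      + B.br₁ (B.one (F₀ x₃)) (F₂ x₁ x₂ x₄) (B.one (F₀ x₅))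
      + B.br₁ (B.one (F₀ x₃)) (B.one (F₀ x₄)) (F₂ x₁ x₂ x₅),
     F₂ (A.br₀ x₁ x₂ x₃) x₄ x₅ + F₂ x₃ (A.br₀ x₁ x₂ x₄) x₅ + F₂ x₃ x₄ (A.br₀ x₁ x₂ x₅)]
    [B.br₁ (B.one (F₀ x₁)) (B.one (F₀ x₂)) (F₂ x₃ x₄ x₅),
     F₂ x₁ x₂ (A.br₀ x₃ x₄ x₅),
     F₁ (A.Jac x₁ x₂ x₃ x₄ x₅)]

/-- A 2-homomorphism of Lie triple 2-systems. -/
@[ext] structure TwoHom {A B : LT2.{w, u} k} (F G : Hom A B) where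
  θ : A.Ob →ₗ[k] B.Mor
  s_θ : ∀ x, B.s (θ x) = F.F₀ x
  t_θ : ∀ x, B.t (θ x) = G.F₀ x
  nat : ∀ f, B.Commutes [F.F₁ f, θ (A.t f)] [θ (A.s f), G.F₁ f]
  coh : ∀ x y z, B.Commutes
    [F.F₂ x y z, θ (A.br₀ x y z)] [B.br₁ (θ x) (θ y) (θ z), G.F₂ x y z]

theorem Hom.ext_data {A B : LT2.{w, u} k} {F G : Hom A B} (h : F.toHomData = G.toHomData) :
    F = G := by
  cases F; cases G; cases h; rfl

section Lemmas

variable {A B : LT2.{w, u} k}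

theorem Hom.nat_eq (F : Hom A B) (f g h) : F.F₁ (A.br₁ f g h) =
    B.br₁ (F.F₁ f) (F.F₁ g) (F.F₁ h) + F.F₂ (A.t f) (A.t g) (A.t h)
      - F.F₂ (A.s f) (A.s g) (A.s h)
      + B.one (F.F₀ (A.br₀ (A.s f) (A.s g) (A.s h)))
      - B.one (B.br₀ (F.F₀ (A.t f)) (F.F₀ (A.t g)) (F.F₀ (A.t h))) := by
  have h := ((B.commutes₂₂ _ _ _ _).1 (F.F₂_nat f g h)).2.2
  simp only [B.t_br, F.t_F₁, F.t_F₂] at h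
  linear_combination (norm := abel) -h

theorem TwoHom.nat_eq {F G : Hom A B} (σ : TwoHom F G) (f) : G.F₁ f =
    F.F₁ f + σ.θ (A.t f) - σ.θ (A.s f) + B.one (G.F₀ (A.s f)) - B.one (F.F₀ (A.t f)) := by
  have h := ((B.commutes₂₂ _ _ _ _).1 (σ.nat f)).2.2
  simp only [F.t_F₁, σ.t_θ] at h
  linear_combination (norm := abel) -h

end Lemmas

/-- The identity homomorphism. -/
def Hom.id (A : LT2.{w, u} k) : Hom A A where
  F₀ := LinearMap.id
  F₁ := LinearMap.id
  F₂ := trilin (fun x y z => A.one (A.br₀ x y z)) (by simp) (by simp) (by simp) (by simp)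
    (by simp) (by simp)
  s_F₁ _ := rfl
  t_F₁ _ := rfl
  F₁_one _ := rfl
  F₁_comp f g h := by
    rw [A.commutes₂₁, A.cmp_eq]
    exact ⟨h, rfl⟩
  s_F₂ _ _ _ := A.s_one _
  t_F₂ _ _ _ := A.t_one _
  F₂_nat f g h := by
    rw [A.commutes₂₂]
    simp [A.s_br, A.t_br, A.s_one, A.t_one]
  alt x y := by simp [A.br₀_alt]
  cyc x y z := by
    have h := congrArg A.one (A.br₀_cyc x y z)
    simp only [map_add, map_zero] at h
    simp only [trilin_apply]
    linear_combination (norm := abel) h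
  coh x₁ x₂ x₃ x₄ x₅ := by
    rw [A.commutes₃₃]
    simp [A.s_one, A.t_one, A.s_Jac, A.t_Jac, A.br_one]

/-- The composite of `F` followed by `G`. -/
def Hom.comp {A B C : LT2.{w, u} k} (F : Hom A B) (G : Hom B C) : Hom A C where
  F₀ := G.F₀ ∘ₗ F.F₀
  F₁ := G.F₁ ∘ₗ F.F₁
  F₂ := trilin (fun x y z => C.cmp (G.F₂ (F.F₀ x) (F.F₀ y) (F.F₀ z)) (G.F₁ (F.F₂ x y z))
      (by rw [G.t_F₂, G.s_F₁, F.s_F₂]))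
    (by intros; simp [C.cmp_eq]; abel) (by intros; simp [C.cmp_eq, smul_sub])
    (by intros; simp [C.cmp_eq]; abel) (by intros; simp [C.cmp_eq, smul_sub])
    (by intros; simp [C.cmp_eq]; abel) (by intros; simp [C.cmp_eq, smul_sub])
  s_F₁ f := by simp [F.s_F₁, G.s_F₁]
  t_F₁ f := by simp [F.t_F₁, G.t_F₁]
  F₁_one x := by simp [F.F₁_one, G.F₁_one]
  F₁_comp f g h := by
    rw [C.commutes₂₁, A.cmp_eq]
    simp [F.s_F₁, G.s_F₁, F.t_F₁, G.t_F₁, F.F₁_one, G.F₁_one, h]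
  s_F₂ x y z := by simp [C.cmp_eq, G.s_F₂, G.t_F₂, G.s_F₁, F.s_F₂, C.s_one]
  t_F₂ x y z := by simp [C.cmp_eq, G.t_F₂, G.t_F₁, F.t_F₂, C.t_one]
  F₂_nat f g h := by
    rw [C.commutes₂₂]
    simp only [trilin_apply, C.cmp_eq, LinearMap.comp_apply, map_add, map_sub, C.s_br, C.t_br,
      G.s_F₂, G.t_F₂, F.s_F₂, F.t_F₂, G.s_F₁, G.t_F₁, F.s_F₁, F.t_F₁, C.s_one, C.t_one,
      F.nat_eq, G.nat_eq, G.F₁_one]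
    refine ⟨by abel, by abel, by abel⟩
  alt x y := by
    have h := F.alt x y
    simp [C.cmp_eq, F.alt, G.alt, G.t_F₂, B.br₀_alt]
  cyc x y z := by
    have h := congrArg (fun x => C.one (G.F₀ x)) (B.br₀_cyc (F.F₀ x) (F.F₀ y) (F.F₀ z))
    have h₁ := congrArg G.F₁ (F.cyc x y z)
    have h₂ := G.cyc (F.F₀ x) (F.F₀ y) (F.F₀ z)
    simp only [trilin_apply, C.cmp_eq, map_add, map_sub, map_neg, map_zero, G.t_F₂] at *
    linear_combination (norm := abel) h₁ + h₂ - h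
  coh x₁ x₂ x₃ x₄ x₅ := by
    have hF := congrArg G.F₁ ((B.commutes₃₃ _ _ _ _ _ _).1 (F.coh x₁ x₂ x₃ x₄ x₅)).2.2
    have hG := ((C.commutes₃₃ _ _ _ _ _ _).1
      (G.coh (F.F₀ x₁) (F.F₀ x₂) (F.F₀ x₃) (F.F₀ x₄) (F.F₀ x₅))).2.2
    rw [C.commutes₃₃]
    simp only [trilin_apply, C.cmp_eq, LinearMap.comp_apply, map_add, map_sub,
      LinearMap.add_apply, LinearMap.sub_apply, C.s_br, C.t_br, B.t_br, B.s_one,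
      B.t_one, G.s_F₂, G.t_F₂, F.s_F₂, F.t_F₂, G.s_F₁, G.t_F₁, F.s_F₁, C.s_one, C.t_one,
      G.nat_eq, G.F₁_one, A.s_Jac, B.t_Jac, C.t_Jac, C.br_one] at *
    refine ⟨⟨by abel, by abel⟩, ⟨by abel, by abel⟩, ?_⟩
    linear_combination (norm := abel) hF + hG

/-- The identity 2-homomorphism. -/
def TwoHom.id {A B : LT2.{w, u} k} (F : Hom A B) : TwoHom F F where
  θ := B.one ∘ₗ F.F₀
  s_θ _ := B.s_one _
  t_θ _ := B.t_one _
  nat f := by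
    rw [B.commutes₂₂]
    simp [F.s_F₁, F.t_F₁, B.s_one, B.t_one]
  coh x y z := by
    rw [B.commutes₂₂]
    simp [F.s_F₂, F.t_F₂, B.s_one, B.t_one, B.br_one]

/-- Vertical composition of 2-homomorphisms. -/
def TwoHom.vcomp {A B : LT2.{w, u} k} {F G H : Hom A B} (σ : TwoHom F G) (τ : TwoHom G H) :
    TwoHom F H where
  θ := {
    toFun := fun x => B.cmp (σ.θ x) (τ.θ x) (by rw [σ.t_θ, τ.s_θ])
    map_add' := by intros; simp [B.cmp_eq]; abel
    map_smul' := by intros; simp [B.cmp_eq, smul_sub] }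
  s_θ x := by simp [B.cmp_eq, σ.s_θ, σ.t_θ, τ.s_θ, B.s_one]
  t_θ x := by simp [B.cmp_eq, σ.t_θ, τ.t_θ, B.t_one]
  nat f := by
    rw [B.commutes₂₂]
    simp only [LinearMap.coe_mk, AddHom.coe_mk, B.cmp_eq, map_add, map_sub, σ.s_θ, σ.t_θ, τ.s_θ,
      τ.t_θ, B.s_one, B.t_one, F.t_F₁, σ.nat_eq, τ.nat_eq, F.s_F₁]
    refine ⟨by abel, by abel, by abel⟩
  coh x y z := by
    have h₁ := ((B.commutes₂₂ _ _ _ _).1 (σ.coh x y z)).2.2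
    have h₂ := ((B.commutes₂₂ _ _ _ _).1 (τ.coh x y z)).2.2
    have h₃ := ((B.commutes₂₁ _ _ _).1 (B.br_comp (σ.θ x) (τ.θ x) (σ.θ y) (τ.θ y) (σ.θ z) (τ.θ z)
      (by rw [σ.t_θ, τ.s_θ]) (by rw [σ.t_θ, τ.s_θ]) (by rw [σ.t_θ, τ.s_θ]))).2
    rw [B.commutes₂₂]
    simp only [LinearMap.coe_mk, AddHom.coe_mk]
    rw [← h₃]
    simp only [B.cmp_eq, map_add, map_sub, σ.s_θ, σ.t_θ, τ.s_θ, τ.t_θ, B.s_one, B.t_one, B.t_br,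
      F.t_F₂, G.t_F₂, H.s_F₂] at *
    refine ⟨by abel, by abel, ?_⟩
    linear_combination (norm := abel) h₁ + h₂

/-- Whiskering `F` followed by `σ`. -/
def TwoHom.whiskerLeft {A B C : LT2.{w, u} k} (F : Hom A B) {G H : Hom B C} (σ : TwoHom G H) :
    TwoHom (F.comp G) (F.comp H) where
  θ := σ.θ ∘ₗ F.F₀
  s_θ x := by simp [σ.s_θ, Hom.comp]
  t_θ x := by simp [σ.t_θ, Hom.comp]
  nat f := by
    have h := σ.nat (F.F₁ f)
    rwa [F.s_F₁, F.t_F₁] at h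
  coh x y z := by
    have h₁ := ((C.commutes₂₂ _ _ _ _).1 (σ.coh (F.F₀ x) (F.F₀ y) (F.F₀ z))).2.2
    have h₂ := σ.nat_eq (F.F₂ x y z)
    rw [C.commutes₂₂]
    simp only [Hom.comp, trilin_apply, LinearMap.comp_apply, C.cmp_eq, map_add, map_sub,
      C.t_br, C.s_one, C.t_one, σ.s_θ, σ.t_θ, G.t_F₂, H.s_F₂, H.t_F₂, G.t_F₁, H.s_F₁,
      F.s_F₂, F.t_F₂] at *
    refine ⟨by abel, by abel, ?_⟩
    linear_combination (norm := abel) h₁ - h₂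

/-- Whiskering `σ` followed by `H`. -/
def TwoHom.whiskerRight {A B C : LT2.{w, u} k} {F G : Hom A B} (σ : TwoHom F G) (H : Hom B C) :
    TwoHom (F.comp H) (G.comp H) where
  θ := H.F₁ ∘ₗ σ.θ
  s_θ x := by simp [σ.s_θ, Hom.comp, H.s_F₁]
  t_θ x := by simp [σ.t_θ, Hom.comp, H.t_F₁]
  nat f := by
    rw [C.commutes₂₂]
    simp only [Hom.comp, LinearMap.comp_apply, H.s_F₁, H.t_F₁, F.s_F₁, F.t_F₁, σ.s_θ, σ.t_θ,
      σ.nat_eq, map_add, map_sub, H.F₁_one, C.s_one]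
    refine ⟨trivial, by abel, by abel⟩
  coh x y z := by
    have h₁ := congrArg H.F₁ ((B.commutes₂₂ _ _ _ _).1 (σ.coh x y z)).2.2
    rw [C.commutes₂₂]
    simp only [Hom.comp, trilin_apply, LinearMap.comp_apply, C.cmp_eq, map_add, map_sub,
      C.t_br, C.s_one, C.t_one, σ.s_θ, σ.t_θ, H.s_F₂, H.t_F₂, H.s_F₁, H.t_F₁, H.nat_eq, H.F₁_one,
      F.t_F₂, G.s_F₂, B.t_br] at *
    refine ⟨by abel, by abel, ?_⟩
    linear_combination (norm := abel) h₁

instance (A B : LT2.{w, u} k) : Category (Hom A B) where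
  Hom := TwoHom
  id := TwoHom.id
  comp := TwoHom.vcomp
  id_comp σ := TwoHom.ext (by
    ext x; simp [TwoHom.vcomp, TwoHom.id, B.cmp_eq, B.t_one])
  comp_id σ := TwoHom.ext (by
    ext x; simp [TwoHom.vcomp, TwoHom.id, B.cmp_eq, σ.t_θ])
  assoc σ τ υ := TwoHom.ext (by
    ext x; simp [TwoHom.vcomp, B.cmp_eq, σ.t_θ, τ.t_θ, B.t_one]; abel)

theorem Hom.comp_F₂ {A B C : LT2.{w, u} k} (F : Hom A B) (G : Hom B C) (x y z : A.Ob) :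
    (F.comp G).F₂ x y z = G.F₂ (F.F₀ x) (F.F₀ y) (F.F₀ z) + G.F₁ (F.F₂ x y z)
      - C.one (G.F₀ (B.br₀ (F.F₀ x) (F.F₀ y) (F.F₀ z))) := by
  rw [← G.t_F₂]
  exact C.cmp_eq _ _ _

theorem Hom.comp_F₀ {A B C : LT2.{w, u} k} (F : Hom A B) (G : Hom B C) (x : A.Ob) :
    (F.comp G).F₀ x = G.F₀ (F.F₀ x) := rfl

theorem Hom.comp_F₁ {A B C : LT2.{w, u} k} (F : Hom A B) (G : Hom B C) (f : A.Mor) :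
    (F.comp G).F₁ f = G.F₁ (F.F₁ f) := rfl

theorem Hom.id_F₂ (A : LT2.{w, u} k) (x y z : A.Ob) :
    (Hom.id A).F₂ x y z = A.one (A.br₀ x y z) := rfl

theorem Hom.ext_apply {A B : LT2.{w, u} k} {F G : Hom A B} (h₀ : F.F₀ = G.F₀) (h₁ : F.F₁ = G.F₁)
    (h₂ : ∀ x y z, F.F₂ x y z = G.F₂ x y z) : F = G :=
  Hom.ext_data (HomData.ext h₀ h₁ (by ext x y z; exact h₂ x y z))

theorem Hom.id_comp {A B : LT2.{w, u} k} (F : Hom A B) : (Hom.id A).comp F = F :=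
  Hom.ext_apply rfl rfl fun x y z => by
    rw [Hom.comp_F₂, Hom.id_F₂, F.F₁_one]
    exact add_sub_cancel_right _ _

theorem Hom.comp_id {A B : LT2.{w, u} k} (F : Hom A B) : F.comp (Hom.id B) = F :=
  Hom.ext_apply rfl rfl fun x y z => by
    rw [Hom.comp_F₂, Hom.id_F₂]
    exact add_sub_cancel_left _ _

theorem Hom.assoc {A B C D : LT2.{w, u} k} (F : Hom A B) (G : Hom B C) (H : Hom C D) :
    (F.comp G).comp H = F.comp (G.comp H) :=
  Hom.ext_apply (LinearMap.ext fun x => by simp only [Hom.comp_F₀])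
    (LinearMap.ext fun x => by simp only [Hom.comp_F₁]) fun x y z => by
    simp only [Hom.comp_F₂, Hom.comp_F₀, Hom.comp_F₁, map_add, map_sub, H.F₁_one]
    abel

theorem twoHom_ext {A B : LT2.{w, u} k} {F G : Hom A B} {σ τ : F ⟶ G}
    (h : ∀ x, TwoHom.θ σ x = TwoHom.θ τ x) : σ = τ :=
  TwoHom.ext (LinearMap.ext h)

theorem comp_θ {A B : LT2.{w, u} k} {F G H : Hom A B} (σ : F ⟶ G) (τ : G ⟶ H) (x : A.Ob) :
    TwoHom.θ (σ ≫ τ) x = TwoHom.θ σ x + TwoHom.θ τ x - B.one (G.F₀ x) := by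
  have h : TwoHom.θ (σ ≫ τ) x = TwoHom.θ σ x + TwoHom.θ τ x - B.one (B.t (TwoHom.θ σ x)) :=
    B.cmp_eq _ _ _
  rw [h, TwoHom.t_θ]

/-- The identity 2-homomorphism between equal homomorphisms. -/
def oneIso {A B : LT2.{w, u} k} {F G : Hom A B} (h : F = G) : F ≅ G where
  hom := { TwoHom.id F with
    t_θ := by subst h; exact (TwoHom.id F).t_θ
    nat := by subst h; exact (TwoHom.id F).nat
    coh := by subst h; exact (TwoHom.id F).coh }
  inv := { TwoHom.id G with
    t_θ := by subst h; exact (TwoHom.id F).t_θ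
    nat := by subst h; exact (TwoHom.id F).nat
    coh := by subst h; exact (TwoHom.id F).coh }
  hom_inv_id := by subst h; exact Category.id_comp (𝟙 F)
  inv_hom_id := by subst h; exact Category.id_comp (𝟙 F)

theorem oneIso_eq {A B : LT2.{w, u} k} {F G : Hom A B} (h : F = G) : oneIso h = eqToIso h := by
  subst h; rfl

theorem oneIso_hom_θ {A B : LT2.{w, u} k} {F G : Hom A B} (h : F = G) (x : A.Ob) :
    TwoHom.θ (oneIso h).hom x = B.one (F.F₀ x) := rfl

theorem oneIso_inv_θ {A B : LT2.{w, u} k} {F G : Hom A B} (h : F = G) (x : A.Ob) :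
    TwoHom.θ (oneIso h).inv x = B.one (G.F₀ x) := rfl

theorem whiskerLeft_θ {A B C : LT2.{w, u} k} (F : Hom A B) {G H : Hom B C} (σ : TwoHom G H)
    (x : A.Ob) : (TwoHom.whiskerLeft F σ).θ x = σ.θ (F.F₀ x) := rfl

theorem whiskerRight_θ {A B C : LT2.{w, u} k} {F G : Hom A B} (σ : TwoHom F G) (H : Hom B C)
    (x : A.Ob) : (TwoHom.whiskerRight σ H).θ x = H.F₁ (σ.θ x) := rfl

theorem id_θ {A B : LT2.{w, u} k} (F : Hom A B) (x : A.Ob) :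
    TwoHom.θ (𝟙 F) x = B.one (F.F₀ x) := rfl

/-- The 2-category of Lie triple 2-systems. -/
instance : Bicategory (LT2.{w, u} k) where
  Hom := Hom
  id := Hom.id
  comp := Hom.comp
  homCategory := inferInstance
  whiskerLeft F _ _ σ := TwoHom.whiskerLeft F σ
  whiskerRight σ H := TwoHom.whiskerRight σ H
  associator F G H := oneIso (Hom.assoc F G H)
  leftUnitor F := oneIso (Hom.id_comp F)
  rightUnitor F := oneIso (Hom.comp_id F)
  whiskerLeft_id _ _ := twoHom_ext fun _ => rfl
  whiskerLeft_comp _ _ _ _ _ _ := twoHom_ext fun _ => rfl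
  id_whiskerLeft σ := twoHom_ext fun x => by
    rw [comp_θ, comp_θ, oneIso_hom_θ, oneIso_inv_θ, whiskerLeft_θ]
    simp [Hom.comp, Hom.id]
  comp_whiskerLeft _ _ _ _ σ := twoHom_ext fun x => by
    rw [comp_θ, comp_θ, oneIso_hom_θ, oneIso_inv_θ, whiskerLeft_θ]
    simp [Hom.comp]; rfl
  id_whiskerRight F G := twoHom_ext fun x => by
    rw [whiskerRight_θ, id_θ, id_θ, G.F₁_one]; rfl
  comp_whiskerRight σ τ H := twoHom_ext fun x => by
    rw [whiskerRight_θ, comp_θ, comp_θ, map_sub, map_add, H.F₁_one]; rfl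
  whiskerRight_id σ := twoHom_ext fun x => by
    rw [comp_θ, comp_θ, oneIso_hom_θ, oneIso_inv_θ, whiskerRight_θ]
    simp [Hom.comp, Hom.id]
  whiskerRight_comp _ _ _ := twoHom_ext fun x => by
    rw [comp_θ, comp_θ, oneIso_hom_θ, oneIso_inv_θ, whiskerRight_θ]
    simp [Hom.comp]; rfl
  whisker_assoc _ _ _ _ _ := twoHom_ext fun x => by
    rw [comp_θ, comp_θ, oneIso_hom_θ, oneIso_inv_θ, whiskerRight_θ]
    simp [Hom.comp, whiskerLeft_θ]; rfl
  whisker_exchange {A B C F G H K} σ τ := twoHom_ext fun x => by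
    rw [comp_θ, comp_θ, whiskerRight_θ, whiskerRight_θ, whiskerLeft_θ, whiskerLeft_θ,
      TwoHom.nat_eq τ, TwoHom.t_θ, TwoHom.s_θ]
    simp only [Hom.comp, LinearMap.comp_apply]
    abel
  pentagon {A B C D E} F G H K := twoHom_ext fun x => by
    rw [comp_θ, comp_θ, comp_θ, whiskerRight_θ, whiskerLeft_θ]
    have h : ∀ y, K.F₁ (D.one y) + (E.one (K.F₀ y) + E.one (K.F₀ y) - E.one (K.F₀ y))
        - E.one (K.F₀ y) = E.one (K.F₀ y) + E.one (K.F₀ y) - E.one (K.F₀ y) := fun y => by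
      rw [K.F₁_one]; abel
    exact h (H.F₀ (G.F₀ (F.F₀ x)))
  triangle {A B C} F G := twoHom_ext fun x => by
    rw [comp_θ, whiskerRight_θ, whiskerLeft_θ]
    have h : ∀ y, C.one (G.F₀ y) + C.one (G.F₀ y) - C.one (G.F₀ y) = G.F₁ (B.one y) :=
      fun y => by rw [G.F₁_one]; abel
    exact h (F.F₀ x)

instance : Bicategory.Strict (LT2.{w, u} k) where
  id_comp := Hom.id_comp
  comp_id := Hom.comp_id
  assoc := Hom.assoc
  leftUnitor_eqToIso _ := oneIso_eq _
  rightUnitor_eqToIso _ := oneIso_eq _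
  associator_eqToIso _ _ _ := oneIso_eq _

end LT2

/-! ### The explicit 2-functors -/

section Explicit

variable {k : Type w} [Field k]

/-- The Lie triple 2-system assigned to a 2-term homotopy Lie triple system (its data). -/
abbrev TObj (X : HLTSData.{w, u} k) : LT2Data.{w, u} k where
  Ob := X.X₀
  Mor := X.X₀ × X.X₁
  s := LinearMap.fst k X.X₀ X.X₁
  t := LinearMap.fst k X.X₀ X.X₁ + X.d ∘ₗ LinearMap.snd k X.X₀ X.X₁
  one := LinearMap.inl k X.X₀ X.X₁
  comp := {
    toFun := fun p => (p.1.1.1, p.1.1.2 + p.1.2.2)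
    map_add' := fun p q => by ext <;> simp; abel
    map_smul' := fun c p => by ext <;> simp }
  s_one _ := rfl
  t_one x := by simp
  s_comp _ _ _ := rfl
  t_comp f g h := by
    have h' : f.1 + X.d f.2 = g.1 := h
    simp [← h', add_assoc]
  one_comp f := by ext <;> simp
  comp_one f := by ext <;> simp
  assoc f g h _ _ := by ext <;> simp [add_assoc]
  br₀ := X.br
  br₁ := trilin (fun P Q R => (X.br P.1 Q.1 R.1,
      X.brR P.1 Q.1 R.2 + X.brM P.1 Q.2 R.1 + X.brL P.2 Q.1 R.1
        + X.brM (X.d P.2) Q.2 R.1 + X.brR (X.d P.2) Q.1 R.2 + X.brR P.1 (X.d Q.2) R.2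
        + X.brR (X.d P.2) (X.d Q.2) R.2))
    (by intros; ext <;> simp; abel) (by intros; ext <;> simp)
    (by intros; ext <;> simp; abel) (by intros; ext <;> simp)
    (by intros; ext <;> simp; abel) (by intros; ext <;> simp)
  Jac := pentalin (fun x₁ x₂ x₃ x₄ x₅ => (X.br x₁ x₂ (X.br x₃ x₄ x₅), X.J x₁ x₂ x₃ x₄ x₅))
    (by intros; ext <;> simp) (by intros; ext <;> simp) (by intros; ext <;> simp)
    (by intros; ext <;> simp) (by intros; ext <;> simp) (by intros; ext <;> simp)
    (by intros; ext <;> simp) (by intros; ext <;> simp) (by intros; ext <;> simp)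
    (by intros; ext <;> simp)

/-- `(x, y, z) ↦ ([φ₀ x, φ₀ y, φ₀ z], φ₂ (x, y, z))`. -/
def TMapF₂ {X Y : HLTSData.{w, u} k} (φ : HLTS.HomData X Y) :
    X.X₀ →ₗ[k] X.X₀ →ₗ[k] X.X₀ →ₗ[k] (Y.X₀ × Y.X₁) :=
  trilin (fun x y z => (Y.br (φ.φ₀ x) (φ.φ₀ y) (φ.φ₀ z), φ.φ₂ x y z))
    (by intros; ext <;> simp) (by intros; ext <;> simp) (by intros; ext <;> simp)
    (by intros; ext <;> simp) (by intros; ext <;> simp) (by intros; ext <;> simp)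

/-- The homomorphism of Lie triple 2-systems assigned to a homomorphism of 2-term homotopy Lie
triple systems (its data). -/
def TMap {X Y : HLTSData.{w, u} k} (φ : HLTS.HomData X Y) : LT2.HomData (TObj X) (TObj Y) where
  F₀ := φ.φ₀
  F₁ := LinearMap.prodMap φ.φ₀ φ.φ₁
  F₂ := TMapF₂ φ

/-- The natural transformation assigned to a 2-homomorphism of 2-term homotopy Lie triple
systems, `x ↦ (φ₀ x, τ x)`. -/
def TMap₂ {X Y : HLTS.{w, u} k} {φ ψ : HLTS.Hom X Y} (σ : HLTS.TwoHom φ ψ) :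
    (TObj X.toHLTSData).Ob →ₗ[k] (TObj Y.toHLTSData).Mor :=
  LinearMap.prod φ.φ₀ σ.τ

/-- The arrow part `f - 1_{s f}` of a morphism of a 2-vector space. -/
def TwoVect.arrow (V : TwoVect.{w, u} k) : V.Mor →ₗ[k] LinearMap.ker V.s :=
  LinearMap.codRestrict (LinearMap.ker V.s) (LinearMap.id - V.one ∘ₗ V.s)
    (fun f => by simp [V.s_one])

/-- The 2-term homotopy Lie triple system assigned to a Lie triple 2-system (its data). -/
abbrev SObj (L : LT2.{w, u} k) : HLTSData.{w, u} k where
  X₀ := L.Ob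
  X₁ := LinearMap.ker L.s
  d := L.t ∘ₗ (LinearMap.ker L.s).subtype
  br := L.br₀
  brL := trilin (fun f x y => ⟨L.br₁ f (L.one x) (L.one y), by simp [L.s_br]⟩)
    (by intros; ext; simp) (by intros; ext; simp) (by intros; ext; simp)
    (by intros; ext; simp) (by intros; ext; simp) (by intros; ext; simp)
  brM := trilin (fun x f y => ⟨L.br₁ (L.one x) f (L.one y), by simp [L.s_br]⟩)
    (by intros; ext; simp) (by intros; ext; simp) (by intros; ext; simp)
    (by intros; ext; simp) (by intros; ext; simp) (by intros; ext; simp)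
  brR := trilin (fun x y f => ⟨L.br₁ (L.one x) (L.one y) f, by simp [L.s_br]⟩)
    (by intros; ext; simp) (by intros; ext; simp) (by intros; ext; simp)
    (by intros; ext; simp) (by intros; ext; simp) (by intros; ext; simp)
  J := pentalin (fun x₁ x₂ x₃ x₄ x₅ => L.arrow (L.Jac x₁ x₂ x₃ x₄ x₅))
    (by simp) (by simp) (by simp) (by simp) (by simp) (by simp) (by simp) (by simp) (by simp)
    (by simp)

/-- `(x, y, z) ↦ F₂ (x, y, z) - 1_{s (F₂ (x, y, z))}`. -/
def SMapφ₂ {L M : LT2Data.{w, u} k} (F : LT2.HomData L M) :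
    L.Ob →ₗ[k] L.Ob →ₗ[k] L.Ob →ₗ[k] LinearMap.ker M.s :=
  trilin (fun x y z => M.arrow (F.F₂ x y z))
    (by simp) (by simp) (by simp) (by simp) (by simp) (by simp)

/-- The homomorphism of 2-term homotopy Lie triple systems assigned to a homomorphism of Lie
triple 2-systems (its data). -/
def SMap {L M : LT2.{w, u} k} (F : LT2.Hom L M) : HLTS.HomData (SObj L) (SObj M) where
  φ₀ := F.F₀
  φ₁ := LinearMap.restrict F.F₁ (p := LinearMap.ker L.s) (q := LinearMap.ker M.s)
    (fun f hf => by
      rw [LinearMap.mem_ker] at hf ⊢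
      rw [F.s_F₁, hf, map_zero])
  φ₂ := SMapφ₂ F.toHomData

/-- The chain homotopy assigned to a 2-homomorphism of Lie triple 2-systems,
`x ↦ θ x - 1_{s (θ x)}`. -/
def SMap₂ {L M : LT2.{w, u} k} {F G : LT2.Hom L M} (σ : LT2.TwoHom F G) :
    (SObj L).X₀ →ₗ[k] (SObj M).X₁ :=
  M.arrow ∘ₗ σ.θ

/-- The strict 2-functor `T` is given by the formulas above. (The second and third condition are
heterogeneous equalities only because source and target of `T.map φ` are described by an equality
of objects, the first condition.) -/
structure IsExplicitT (T : StrictPseudofunctor (HLTS.{w, u} k) (LT2.{w, u} k)) : Prop where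
  obj : ∀ X, (T.obj X).toLT2Data = TObj X.toHLTSData
  map : ∀ {X Y : HLTS.{w, u} k} (φ : X ⟶ Y),
    HEq (LT2.Hom.toHomData (T.map φ)) (TMap (HLTS.Hom.toHomData φ))
  map₂ : ∀ {X Y : HLTS.{w, u} k} {φ ψ : X ⟶ Y} (σ : φ ⟶ ψ),
    HEq (LT2.TwoHom.θ (T.map₂ σ)) (TMap₂ σ)

/-- The strict 2-functor `S` is given by the formulas above. -/
structure IsExplicitS (S : StrictPseudofunctor (LT2.{w, u} k) (HLTS.{w, u} k)) : Prop where
  obj : ∀ L, (S.obj L).toHLTSData = SObj L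
  map : ∀ {L M : LT2.{w, u} k} (F : L ⟶ M),
    HEq (HLTS.Hom.toHomData (S.map F)) (SMap F)
  map₂ : ∀ {L M : LT2.{w, u} k} {F G : L ⟶ M} (σ : F ⟶ G),
    HEq (HLTS.TwoHom.τ (S.map₂ σ)) (SMap₂ σ)

end Explicit

/-! ### 2-equivalence -/

/-- A 2-natural isomorphism between strict 2-functors: a strictly natural family of (strictly)
invertible 1-morphisms, natural with respect to 2-morphisms as well. -/
structure TwoNatIso {B C : Type*} [Bicategory B] [Bicategory C] (F G : StrictPseudofunctor B C) where
  app : ∀ a, F.obj a ⟶ G.obj a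
  inv : ∀ a, G.obj a ⟶ F.obj a
  app_inv : ∀ a, app a ≫ inv a = 𝟙 (F.obj a)
  inv_app : ∀ a, inv a ≫ app a = 𝟙 (G.obj a)
  naturality : ∀ {a b : B} (f : a ⟶ b), F.map f ≫ app b = app a ≫ G.map f
  naturality₂ : ∀ {a b : B} {f g : a ⟶ b} (η : f ⟶ g),
    F.map₂ η ▷ app b ≫ eqToHom (naturality g) = eqToHom (naturality f) ≫ app a ◁ G.map₂ η

/-- `T` and `S` are mutually quasi-inverse 2-equivalences: both composites are 2-naturally
isomorphic to the identity. -/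
def AreTwoEquivalences {B C : Type*} [Bicategory B] [Bicategory C] (T : StrictPseudofunctor B C)
    (S : StrictPseudofunctor C B) : Prop :=
  Nonempty (TwoNatIso (S.comp T) (StrictPseudofunctor.id C)) ∧
    Nonempty (TwoNatIso (T.comp S) (StrictPseudofunctor.id B))

end LieTriple

/-! A 2-vector space is the same thing as a 2-term complex. Composition is forced by linearity: `f`
followed by `g` is `f + g - 1_{t f}` (`TwoVect.cmp_eq`), and every morphism splits uniquely as `f =
1_{s f} + (f - 1_{s f})`, the second summand (the arrow part) lying in `ker s`. So a commutative
diagram amounts to composability of its paths together with one linear equation, and after removing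
identities that equation lives in `ker s`. The theorem says that this dictionary matches the axioms
on the two sides.

Composability is governed by the formulas for `d`, and the source components of the linear equations
then hold automatically. The arrow components of the coherence conditions are the corresponding
identities of homotopy Lie triple systems. Invertibility of the fundamentor is automatic.

Two points need more than translation. Functoriality of the bracket on morphisms corresponds to the
relations `[df,g,x] = [f,dg,x]` and `[df,x,g] = [f,x,dg]`: they let a mixed bracket of arrow parts
be written with a single arrow part (`TObj_br₁`, `br₁_one_one` and its variants), whence the
seven-term formulas for the bracket and for homotopies. Naturality of the fundamentor in five
morphisms at once has to be derived from conditions in which a single argument varies; since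
naturality squares paste, it suffices to move one argument at a time (`JNatural.add`, `jNatural`).

For `TS ≅ 1` the components are `(x, f) ↦ 1_x + f`; for `ST ≅ 1` they identify the kernel of the
first projection of `X₀ × X₁` with `X₁`. Both preserve all the structure strictly. Characteristic
different from `2` serves to pass from skew-symmetry to the alternating law in the construction of
`T`. -/

namespace LieTriple

section

variable {k : Type w} [Field k]

/-! ### Paths of length four in a 2-vector space -/

namespace TwoVect

variable (V : TwoVect.{w, u} k)

theorem isComposite_four (f g h i m : V.Mor) : V.IsComposite [f, g, h, i] m ↔
    V.t f = V.s g ∧ V.t g = V.s h ∧ V.t h = V.s i ∧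
      f + (g + (h + i - V.one (V.t h)) - V.one (V.t g)) - V.one (V.t f) = m := by
  rw [IsComposite]
  simp only [isComposite_three, cmp_eq, exists_prop]
  constructor
  · rintro ⟨_, ⟨h₁, h₂, rfl⟩, h₃, rfl⟩
    refine ⟨?_, h₁, h₂, rfl⟩
    simpa [V.s_one, h₁, h₂] using h₃
  · rintro ⟨h₁, h₂, h₃, rfl⟩
    exact ⟨_, ⟨h₂, h₃, rfl⟩, by simp [V.s_one, h₁, h₂, h₃], rfl⟩

/-- This is the shape of the fundamental identity `Jac_coh`, whose two sides are paths of four and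
three arrows; it becomes a list of matching conditions and one linear equation. -/
theorem commutes₄₃ (f g h i f' g' h' : V.Mor) : V.Commutes [f, g, h, i] [f', g', h'] ↔
    (V.t f = V.s g ∧ V.t g = V.s h ∧ V.t h = V.s i) ∧ (V.t f' = V.s g' ∧ V.t g' = V.s h') ∧
      f + (g + (h + i - V.one (V.t h)) - V.one (V.t g)) - V.one (V.t f) =
        f' + (g' + h' - V.one (V.t g')) - V.one (V.t f') := by
  simp only [Commutes, isComposite_three, isComposite_four]
  constructor
  · rintro ⟨m, ⟨h₁, h₁', h₁'', h₂⟩, h₃, h₃', h₄⟩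
    exact ⟨⟨h₁, h₁', h₁''⟩, ⟨h₃, h₃'⟩, h₂.trans h₄.symm⟩
  · rintro ⟨⟨h₁, h₁', h₁''⟩, ⟨h₂, h₂'⟩, h₃⟩
    exact ⟨_, ⟨h₁, h₁', h₁'', rfl⟩, h₂, h₂', h₃.symm⟩

end TwoVect

/-- The one place where the characteristic matters: homotopy Lie triple systems have skew brackets,
Lie triple 2-systems alternating ones. -/
theorem eq_zero_of_eq_neg {M : Type*} [AddCommGroup M] [Module k M] (h2 : (2 : k) ≠ 0) {a : M}
    (h : a = -a) : a = 0 := by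
  have h' : (2 : k) • a = 0 := by
    rw [two_smul]
    nth_rewrite 1 [h]
    exact neg_add_cancel a
  exact (smul_eq_zero.1 h').resolve_left h2

/-! ### From 2-term homotopy Lie triple systems to Lie triple 2-systems -/

namespace HLTS

variable (X : HLTS.{w, u} k)

theorem J_skew (x₁ x₂ x y z) : X.J x₁ x₂ x y z = -X.J x₁ x₂ y x z := by
  have h := X.J_alt x₁ x₂ (x + y) z
  simp only [map_add, LinearMap.add_apply, X.J_alt, zero_add, add_zero] at h
  exact eq_neg_of_add_eq_zero_right h

/-- `J` is skew in its third and fourth arguments, so the condition for position 4, absent from the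
axioms, follows from the one for position 3. -/
theorem J_d₄ (x₁ x₂ x₃ f x₅) : X.J x₁ x₂ x₃ (X.d f) x₅ =
    -X.brR x₁ x₂ (X.brM x₃ f x₅) + X.brM x₃ (X.brR x₁ x₂ f) x₅ + X.brM (X.br x₁ x₂ x₃) f x₅
      + X.brM x₃ f (X.br x₁ x₂ x₅) := by
  rw [X.J_skew, X.J_d₃]
  simp only [X.brM_skew x₃, X.brM_skew (X.br x₁ x₂ x₃), map_neg]
  abel

/-- The arrow part of the bracket of the morphisms `(x, f)`, `(y, g)`, `(z, h)`. -/
def arrBr (x : X.X₀) (f : X.X₁) (y : X.X₀) (g : X.X₁) (z : X.X₀) (h : X.X₁) : X.X₁ :=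
  X.brR x y h + X.brM x g (z + X.d h) + X.brL f (y + X.d g) (z + X.d h)

/-- The seven summands collapse to three when the third slot is moved along its arrow first, then
the second, then the first: the later arrows see the already displaced arguments, and `brM_d`,
`brM_dR`, `brR_d` identify the mixed terms. -/
theorem TObj_br₁ (x f y g z h) : (TObj X.toHLTSData).br₁ (x, f) (y, g) (z, h) =
    (X.br x y z, X.arrBr x f y g z h) := by
  simp only [trilin_apply, arrBr, map_add, LinearMap.add_apply, X.brM_d, X.brM_dR, X.brR_d]
  congr 1
  abel

/-- Functoriality of the bracket, read on arrow parts: composing morphisms adds arrow parts, the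
second one being based at the target of the first. -/
theorem arrBr_add (x f f' y g g' z h h') :
    X.arrBr x (f + f') y (g + g') z (h + h') = X.arrBr x f y g z h +
      X.arrBr (x + X.d f) f' (y + X.d g) g' (z + X.d h) h' := by
  simp only [arrBr, map_add, LinearMap.add_apply, X.brM_d, X.brM_dR, X.brR_d]
  abel

theorem add_d_arrBr (x f y g z h) : X.br x y z + X.d (X.arrBr x f y g z h) =
    X.br (x + X.d f) (y + X.d g) (z + X.d h) := by
  simp only [arrBr, map_add, LinearMap.add_apply, X.d_brR, X.d_brM, X.d_brL]
  abel

theorem TObj_one (x) : (TObj X.toHLTSData).one x = (x, 0) := rfl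

theorem arrBr_zero (x y z) : X.arrBr x 0 y 0 z 0 = 0 := by simp [arrBr]

/-- Naturality of the 5-linear map `J` with respect to the morphisms `(xᵢ, fᵢ)`. -/
def JNatural (x₁ : X.X₀) (f₁ : X.X₁) (x₂ : X.X₀) (f₂ : X.X₁) (x₃ : X.X₀) (f₃ : X.X₁) (x₄ : X.X₀)
    (f₄ : X.X₁) (x₅ : X.X₀) (f₅ : X.X₁) : Prop :=
  X.arrBr x₁ f₁ x₂ f₂ (X.br x₃ x₄ x₅) (X.arrBr x₃ f₃ x₄ f₄ x₅ f₅)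
      + X.J (x₁ + X.d f₁) (x₂ + X.d f₂) (x₃ + X.d f₃) (x₄ + X.d f₄) (x₅ + X.d f₅) =
    X.J x₁ x₂ x₃ x₄ x₅
      + X.arrBr (X.br x₁ x₂ x₃) (X.arrBr x₁ f₁ x₂ f₂ x₃ f₃) x₄ f₄ x₅ f₅
      + X.arrBr x₃ f₃ (X.br x₁ x₂ x₄) (X.arrBr x₁ f₁ x₂ f₂ x₄ f₄) x₅ f₅
      + X.arrBr x₃ f₃ x₄ f₄ (X.br x₁ x₂ x₅) (X.arrBr x₁ f₁ x₂ f₂ x₅ f₅)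

variable {X} in
-- Naturality squares paste: by `arrBr_add` every iterated bracket of composites splits, and the
-- value of `J` at the intermediate objects cancels.
theorem JNatural.add {x₁ f₁ g₁ x₂ f₂ g₂ x₃ f₃ g₃ x₄ f₄ g₄ x₅ f₅ g₅}
    (hf : X.JNatural x₁ f₁ x₂ f₂ x₃ f₃ x₄ f₄ x₅ f₅)
    (hg : X.JNatural (x₁ + X.d f₁) g₁ (x₂ + X.d f₂) g₂ (x₃ + X.d f₃) g₃ (x₄ + X.d f₄) g₄
      (x₅ + X.d f₅) g₅) :
    X.JNatural x₁ (f₁ + g₁) x₂ (f₂ + g₂) x₃ (f₃ + g₃) x₄ (f₄ + g₄) x₅ (f₅ + g₅) := by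
  have h : ∀ (x : X.X₀) (f g : X.X₁), x + X.d (f + g) = x + X.d f + X.d g := fun x f g => by
    rw [map_add, add_assoc]
  simp only [JNatural, arrBr_add, add_d_arrBr, h] at hf hg ⊢
  linear_combination (norm := abel) hf + hg

/-- A five-tuple of morphisms is a composite of five tuples, each with only one morphism that need
not be an identity; for those, naturality is one of the conditions `J_d₁` to `J_d₅`. -/
theorem jNatural (x₁ f₁ x₂ f₂ x₃ f₃ x₄ f₄ x₅ f₅) : X.JNatural x₁ f₁ x₂ f₂ x₃ f₃ x₄ f₄ x₅ f₅ := by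
  have h₁ : X.JNatural x₁ f₁ x₂ 0 x₃ 0 x₄ 0 x₅ 0 := by
    simp [JNatural, arrBr, X.J_d₁]
    abel
  have h₂ : ∀ x₁, X.JNatural x₁ 0 x₂ f₂ x₃ 0 x₄ 0 x₅ 0 := fun x₁ => by
    simp [JNatural, arrBr, X.J_d₂]
    abel
  have h₃ : ∀ x₁ x₂, X.JNatural x₁ 0 x₂ 0 x₃ f₃ x₄ 0 x₅ 0 := fun x₁ x₂ => by
    simp [JNatural, arrBr, X.J_d₃]
    abel
  have h₄ : ∀ x₁ x₂ x₃, X.JNatural x₁ 0 x₂ 0 x₃ 0 x₄ f₄ x₅ 0 := fun x₁ x₂ x₃ => by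
    simp [JNatural, arrBr, X.J_d₄]
    abel
  have h₅ : ∀ x₁ x₂ x₃ x₄, X.JNatural x₁ 0 x₂ 0 x₃ 0 x₄ 0 x₅ f₅ := fun x₁ x₂ x₃ x₄ => by
    simp [JNatural, arrBr, X.J_d₅]
    abel
  -- The arguments already moved sit at their targets `xᵢ + d fᵢ`, which is why `h₂` to `h₅` were
  -- proved for arbitrary earlier arguments.
  have h := (((h₁.add (by simpa using h₂ (x₁ + X.d f₁))).add
    (g₁ := 0) (g₂ := 0) (g₃ := f₃) (g₄ := 0) (g₅ := 0) (by simpa using h₃ _ _)).add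
    (g₁ := 0) (g₂ := 0) (g₃ := 0) (g₄ := f₄) (g₅ := 0) (by simpa using h₄ _ _ _)).add
    (g₁ := 0) (g₂ := 0) (g₃ := 0) (g₄ := 0) (g₅ := f₅) (by simpa using h₅ _ _ _ _)
  simpa using h

theorem TObj_t_br (x f y g z h) :
    (TObj X.toHLTSData).t ((TObj X.toHLTSData).br₁ (x, f) (y, g) (z, h)) =
      X.br (x + X.d f) (y + X.d g) (z + X.d h) := by
  rw [TObj_br₁]
  exact X.add_d_arrBr x f y g z h

theorem TObj_Jac_nat (P₁ P₂ P₃ P₄ P₅ : X.X₀ × X.X₁) :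
    (TObj X.toHLTSData).Commutes
    [(TObj X.toHLTSData).br₁ P₁ P₂ ((TObj X.toHLTSData).br₁ P₃ P₄ P₅),
      (TObj X.toHLTSData).Jac ((TObj X.toHLTSData).t P₁) ((TObj X.toHLTSData).t P₂)
       ((TObj X.toHLTSData).t P₃) ((TObj X.toHLTSData).t P₄) ((TObj X.toHLTSData).t P₅)]
    [(TObj X.toHLTSData).Jac ((TObj X.toHLTSData).s P₁) ((TObj X.toHLTSData).s P₂)
      ((TObj X.toHLTSData).s P₃) ((TObj X.toHLTSData).s P₄) ((TObj X.toHLTSData).s P₅),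
      (TObj X.toHLTSData).br₁ ((TObj X.toHLTSData).br₁ P₁ P₂ P₃) P₄ P₅
      + (TObj X.toHLTSData).br₁ P₃ ((TObj X.toHLTSData).br₁ P₁ P₂ P₄) P₅
      + (TObj X.toHLTSData).br₁ P₃ P₄ ((TObj X.toHLTSData).br₁ P₁ P₂ P₅)] := by
  obtain ⟨x₁, f₁⟩ := P₁
  obtain ⟨x₂, f₂⟩ := P₂
  obtain ⟨x₃, f₃⟩ := P₃
  obtain ⟨x₄, f₄⟩ := P₄
  obtain ⟨x₅, f₅⟩ := P₅
  rw [TwoVect.commutes₂₂]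
  have h := X.jNatural x₁ f₁ x₂ f₂ x₃ f₃ x₄ f₄ x₅ f₅
  rw [JNatural] at h
  -- Eight brackets occur: an inner and an outer one on the left, and three such pairs on the right.
  iterate 8 rw [TObj_br₁]
  -- Composability of the two paths, then equality of the composites; in the last, the object
  -- coordinate is forced by the first two, and the arrow coordinate is `jNatural`.
  refine ⟨?_, ?_, ?_⟩
  · change X.br x₁ x₂ (X.br x₃ x₄ x₅) + X.d (X.arrBr x₁ f₁ x₂ f₂ (X.br x₃ x₄ x₅)
      (X.arrBr x₃ f₃ x₄ f₄ x₅ f₅)) = _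
    rw [add_d_arrBr, add_d_arrBr]
    rfl
  · change X.br x₁ x₂ (X.br x₃ x₄ x₅) + X.d (X.J x₁ x₂ x₃ x₄ x₅) =
      X.br (X.br x₁ x₂ x₃) x₄ x₅ + X.br x₃ (X.br x₁ x₂ x₄) x₅ + X.br x₃ x₄ (X.br x₁ x₂ x₅)
    rw [X.d_J]
    abel
  · refine Prod.ext ?_ ?_
    · change X.br x₁ x₂ (X.br x₃ x₄ x₅) + _ - _ = X.br x₁ x₂ (X.br x₃ x₄ x₅) +
        (X.br (X.br x₁ x₂ x₃) x₄ x₅ + X.br x₃ (X.br x₁ x₂ x₄) x₅ + X.br x₃ x₄ (X.br x₁ x₂ x₅))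
        - (X.br x₁ x₂ (X.br x₃ x₄ x₅) + X.d (X.J x₁ x₂ x₃ x₄ x₅))
      rw [X.d_J]
      change _ + X.br (x₁ + X.d f₁) (x₂ + X.d f₂) (X.br (x₃ + X.d f₃) (x₄ + X.d f₄) (x₅ + X.d f₅))
        - (X.br x₁ x₂ (X.br x₃ x₄ x₅) + X.d (X.arrBr x₁ f₁ x₂ f₂ (X.br x₃ x₄ x₅)
          (X.arrBr x₃ f₃ x₄ f₄ x₅ f₅))) = _
      rw [add_d_arrBr, add_d_arrBr]
      abel
    · change X.arrBr x₁ f₁ x₂ f₂ (X.br x₃ x₄ x₅) (X.arrBr x₃ f₃ x₄ f₄ x₅ f₅) +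
        X.J (x₁ + X.d f₁) (x₂ + X.d f₂) (x₃ + X.d f₃) (x₄ + X.d f₄) (x₅ + X.d f₅) - 0 =
        X.J x₁ x₂ x₃ x₄ x₅ + (X.arrBr (X.br x₁ x₂ x₃) (X.arrBr x₁ f₁ x₂ f₂ x₃ f₃) x₄ f₄ x₅ f₅
        + X.arrBr x₃ f₃ (X.br x₁ x₂ x₄) (X.arrBr x₁ f₁ x₂ f₂ x₄ f₄) x₅ f₅
        + X.arrBr x₃ f₃ x₄ f₄ (X.br x₁ x₂ x₅) (X.arrBr x₁ f₁ x₂ f₂ x₅ f₅)) - 0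
      linear_combination (norm := abel) h

/-- The Lie triple 2-system assigned to a 2-term homotopy Lie triple system. -/
abbrev toLT2 (h2 : (2 : k) ≠ 0) (X : HLTS.{w, u} k) : LT2.{w, u} k where
  toLT2Data := TObj X.toHLTSData
  s_br _ _ _ := rfl
  t_br P Q R := X.TObj_t_br P.1 P.2 Q.1 Q.2 R.1 R.2
  br_one x y z := by rw [TObj_one, TObj_one, TObj_one, TObj_br₁, arrBr_zero]; rfl
  br_comp P P' Q Q' R R' hP hQ hR := by
    obtain ⟨x, f⟩ := P
    obtain ⟨y, g⟩ := Q
    obtain ⟨z, h⟩ := R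
    obtain ⟨x', f'⟩ := P'
    obtain ⟨y', g'⟩ := Q'
    obtain ⟨z', h'⟩ := R'
    obtain rfl : x + X.d f = x' := hP
    obtain rfl : y + X.d g = y' := hQ
    obtain rfl : z + X.d h = z' := hR
    rw [TwoVect.commutes₂₁]
    refine ⟨X.TObj_t_br _ _ _ _ _ _, ?_⟩
    rw [TObj_t_br]
    simp only [TwoVect.cmp, LinearMap.coe_mk, AddHom.coe_mk, trilin_apply, LinearMap.inl_apply,
      Prod.mk_add_mk, Prod.mk_sub_mk, map_add, LinearMap.add_apply, X.brM_d, X.brM_dR, X.brR_d]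
    congr 1 <;> abel
  br₀_alt x y := eq_zero_of_eq_neg h2 (X.br_skew x x y)
  br₀_cyc := X.br_cyc
  br₁_alt P Q := by
    obtain ⟨x, f⟩ := P
    obtain ⟨y, g⟩ := Q
    have h₁ := eq_zero_of_eq_neg h2 (X.br_skew x x y)
    have h₂ := eq_zero_of_eq_neg h2 (X.brR_skew x x g)
    -- The quadratic term in `f`: `[f, df, w] = [df, f, w] = -[f, df, w]`, so it vanishes.
    have h₃ := eq_zero_of_eq_neg h2 ((X.brM_d f f (y + X.d g)).symm.trans (X.brM_skew _ _ _))
    rw [TObj_br₁]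
    ext
    · exact h₁
    · simp only [arrBr, h₂, X.brM_skew, map_add, LinearMap.add_apply, Prod.snd_zero] at h₃ ⊢
      linear_combination (norm := abel) h₃
  br₁_cyc P Q R := by
    obtain ⟨x, f⟩ := P
    obtain ⟨y, g⟩ := Q
    obtain ⟨z, h⟩ := R
    -- Besides the object part there is one cyclic relation for each nonempty subset of `{f, g, h}`,
    -- matching the seven summands of the bracket on morphisms.
    have h₀ := X.br_cyc x y z
    have h₁ := X.brR_cyc x y h
    have h₂ := X.brR_cyc y z f
    have h₃ := X.brR_cyc z x g
    have h₄ := X.brR_cyc x (X.d g) h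
    have h₅ := X.brR_cyc y (X.d h) f
    have h₆ := X.brR_cyc z (X.d f) g
    have h₇ := X.brR_cyc (X.d f) (X.d g) h
    simp only [trilin_apply, Prod.mk_add_mk, X.brM_d, X.brR_d] at *
    refine Prod.ext h₀ ?_
    simp only [Prod.snd_zero]
    linear_combination (norm := abel) h₁ + h₂ + h₃ + h₄ + h₅ + h₆ + h₇
  s_Jac _ _ _ _ _ := rfl
  t_Jac x₁ x₂ x₃ x₄ x₅ := by
    change _ + X.d (X.J _ _ _ _ _) = _
    rw [X.d_J, pentalin_apply, LinearMap.fst_apply]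
    abel
  Jac_iso _ _ _ _ _ := TwoVect.isIso _ _
  Jac_nat := X.TObj_Jac_nat
  Jac_alt x₁ x₂ x y := by
    rw [pentalin_apply, X.J_alt, eq_zero_of_eq_neg h2 (X.br_skew x x y), map_zero]
    rfl
  Jac_cyc x₁ x₂ x y z := by
    simp only [pentalin_apply, Prod.mk_add_mk]
    exact Prod.ext (by simp [← map_add, X.br_cyc]) (X.J_cyc _ _ _ _ _)
  Jac_coh x₁ x₂ x₃ x₄ x₅ x₆ x₇ := by
    have h := X.J_coh x₁ x₂ x₃ x₄ x₅ x₆ x₇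
    rw [TwoVect.commutes₄₃]
    simp only [map_add, trilin_apply, pentalin_apply, LinearMap.inl_apply, LinearMap.fst_apply,
      LinearMap.snd_apply, LinearMap.comp_apply, LinearMap.add_apply, Prod.mk_add_mk,
      X.d_J, X.d_brR, map_zero, LinearMap.zero_apply, add_zero, zero_add, map_neg]
    -- Once targets are expanded by `d_J`, everything but the arrow coordinate is formal; that
    -- coordinate is `J_coh`, the suppressed identities having arrow part zero.
    refine ⟨⟨by abel, by abel, by abel⟩, ⟨by abel, by abel⟩, Prod.ext ?_ ?_⟩
    · simp only [Prod.fst_add, Prod.fst_sub, Prod.fst_neg]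
      abel
    · simp only [Prod.snd_add, Prod.snd_sub, Prod.snd_neg]
      linear_combination (norm := abel) h

/-- The arrow part of the naturality square of `φ₂`. Moving one slot at a time leaves the three
one-variable relations `φ₂_L`, `φ₂_M`, `φ₂_R`. -/
theorem Hom.arrBr_nat {X Y : HLTS.{w, u} k} (φ : Hom X Y) (x f y g z h) :
    Y.arrBr (φ.φ₀ x) (φ.φ₁ f) (φ.φ₀ y) (φ.φ₁ g) (φ.φ₀ z) (φ.φ₁ h)
        + φ.φ₂ (x + X.d f) (y + X.d g) (z + X.d h) =
      φ.φ₂ x y z + φ.φ₁ (X.arrBr x f y g z h) := by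
  simp only [arrBr, map_add, LinearMap.add_apply, φ.φ₂_L, φ.φ₂_M, φ.φ₂_R, φ.chain,
    X.brM_dR, Y.brM_dR]
  abel

/-- The seven bracket terms in the definition of a 2-homomorphism are the arrow part of `{θ_x, θ_y,
θ_z}` for `θ_x = (φ₀ x, τ x)`. -/
theorem TwoHom.arrBr_nat {X Y : HLTS.{w, u} k} {φ ψ : Hom X Y} (σ : TwoHom φ ψ) (x y z) :
    φ.φ₂ x y z + σ.τ (X.br x y z) =
      Y.arrBr (φ.φ₀ x) (σ.τ x) (φ.φ₀ y) (σ.τ y) (φ.φ₀ z) (σ.τ z) + ψ.φ₂ x y z := by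
  have h := σ.coh x y z
  simp only [arrBr, map_add, LinearMap.add_apply, Y.brM_d, Y.brM_dR, Y.brR_d] at h ⊢
  linear_combination (norm := abel) h

/-- The homomorphism of Lie triple 2-systems assigned to a homomorphism of 2-term homotopy Lie
triple systems. -/
def Hom.toLT2 (h2 : (2 : k) ≠ 0) {X Y : HLTS.{w, u} k} (φ : Hom X Y) :
    LT2.Hom (X.toLT2 h2) (Y.toLT2 h2) where
  toHomData := TMap φ.toHomData
  s_F₁ _ := rfl
  t_F₁ P := by
    change φ.φ₀ P.1 + Y.d (φ.φ₁ P.2) = φ.φ₀ (P.1 + X.d P.2)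
    rw [map_add, φ.chain]
  F₁_one x := Prod.ext rfl (map_zero φ.φ₁)
  F₁_comp P Q h := by
    rw [TwoVect.commutes₂₁]
    obtain ⟨x, f⟩ := P
    obtain ⟨y, g⟩ := Q
    obtain rfl : x + X.d f = y := h
    have h₁ : φ.φ₀ x + Y.d (φ.φ₁ f) = φ.φ₀ (x + X.d f) := by rw [map_add, φ.chain]
    refine ⟨h₁, Prod.ext ?_ ?_⟩
    · change φ.φ₀ x + φ.φ₀ (x + X.d f) - (φ.φ₀ x + Y.d (φ.φ₁ f)) = φ.φ₀ x
      rw [h₁, add_sub_cancel_right]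
    · change φ.φ₁ f + φ.φ₁ g - 0 = φ.φ₁ (f + g)
      rw [map_add, sub_zero]
  s_F₂ _ _ _ := rfl
  t_F₂ x y z := by
    have h := φ.d_φ₂ x y z
    exact (eq_sub_iff_add_eq'.1 h)
  F₂_nat P Q R := by
    obtain ⟨x, f⟩ := P
    obtain ⟨y, g⟩ := Q
    obtain ⟨z, h⟩ := R
    have hn := φ.arrBr_nat x f y g z h
    have ht : ∀ x f, φ.φ₀ (x + X.d f) = φ.φ₀ x + Y.d (φ.φ₁ f) := fun x f => by
      rw [map_add, φ.chain]
    have hs : Y.br (φ.φ₀ x) (φ.φ₀ y) (φ.φ₀ z) + Y.d (φ.φ₂ x y z) = φ.φ₀ (X.br x y z) := by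
      rw [φ.d_φ₂, add_sub_cancel]
    have hb := Y.add_d_arrBr (φ.φ₀ x) (φ.φ₁ f) (φ.φ₀ y) (φ.φ₁ g) (φ.φ₀ z) (φ.φ₁ h)
    simp only [← ht] at hb
    have hY := Y.TObj_br₁ (φ.φ₀ x) (φ.φ₁ f) (φ.φ₀ y) (φ.φ₁ g) (φ.φ₀ z) (φ.φ₁ h)
    rw [TwoVect.commutes₂₂]
    -- The naturality square in coordinates (object, arrow part); the subtracted pairs are the
    -- identities at the intermediate objects.
    change (TObj Y.toHLTSData).t ((TObj Y.toHLTSData).br₁ (φ.φ₀ x, φ.φ₁ f) (φ.φ₀ y, φ.φ₁ g)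
        (φ.φ₀ z, φ.φ₁ h)) =
      Y.br (φ.φ₀ (x + X.d f)) (φ.φ₀ (y + X.d g)) (φ.φ₀ (z + X.d h)) ∧ _ ∧
      (TObj Y.toHLTSData).br₁ (φ.φ₀ x, φ.φ₁ f) (φ.φ₀ y, φ.φ₁ g) (φ.φ₀ z, φ.φ₁ h) +
      ((Y.br (φ.φ₀ (x + X.d f)) (φ.φ₀ (y + X.d g)) (φ.φ₀ (z + X.d h)),
        φ.φ₂ (x + X.d f) (y + X.d g) (z + X.d h)) : Y.X₀ × Y.X₁) -
      ((TObj Y.toHLTSData).t ((TObj Y.toHLTSData).br₁ (φ.φ₀ x, φ.φ₁ f) (φ.φ₀ y, φ.φ₁ g)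
        (φ.φ₀ z, φ.φ₁ h)), 0) =
      ((Y.br (φ.φ₀ x) (φ.φ₀ y) (φ.φ₀ z), φ.φ₂ x y z) : Y.X₀ × Y.X₁) +
      (φ.φ₀ (X.br x y z), φ.φ₁ ((TObj X.toHLTSData).br₁ (x, f) (y, g) (z, h)).2)
      - (Y.br (φ.φ₀ x) (φ.φ₀ y) (φ.φ₀ z) + Y.d (φ.φ₂ x y z), 0)
    rw [TObj_t_br, TObj_br₁, TObj_br₁, hs, ← ht, ← ht, ← ht]
    refine ⟨rfl, hs, ?_⟩
    simp only [Prod.mk_add_mk, Prod.mk_sub_mk, add_sub_cancel_right, sub_zero]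
    rw [hn]
  alt x y := Prod.ext (eq_zero_of_eq_neg h2 (Y.br_skew _ _ _)) (φ.alt x y)
  cyc x y z := by
    have h := Y.br_cyc (φ.φ₀ x) (φ.φ₀ y) (φ.φ₀ z)
    refine Prod.ext ?_ (φ.cyc x y z)
    change Y.br (φ.φ₀ x) (φ.φ₀ y) (φ.φ₀ z) = -Y.br (φ.φ₀ y) (φ.φ₀ z) (φ.φ₀ x)
      - Y.br (φ.φ₀ z) (φ.φ₀ x) (φ.φ₀ y)
    linear_combination (norm := abel) h
  coh x₁ x₂ x₃ x₄ x₅ := by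
    have h := φ.coh x₁ x₂ x₃ x₄ x₅
    rw [TwoVect.commutes₃₃]
    simp only [TMap, TMapF₂, map_add, trilin_apply, pentalin_apply, LinearMap.inl_apply,
      LinearMap.fst_apply, LinearMap.prodMap_apply,
      LinearMap.snd_apply, LinearMap.comp_apply, LinearMap.add_apply, Prod.mk_add_mk,
      Prod.mk_sub_mk, Y.d_J, Y.d_brR, Y.d_brM, Y.d_brL, φ.d_φ₂, map_sub,
      LinearMap.sub_apply, map_zero, LinearMap.zero_apply, add_zero, zero_add, map_neg]
    -- Composability and the object coordinate come from `d_J` and `d_φ₂`; the arrow coordinate is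
    -- `φ.coh`.
    refine ⟨⟨by abel, by abel⟩, ⟨by abel, by abel⟩, Prod.ext ?_ ?_⟩
    · simp only [Prod.fst_add, Prod.fst_sub, Prod.fst_neg]
      abel
    · simp only [Prod.snd_add, Prod.snd_sub, Prod.snd_neg]
      linear_combination (norm := abel) h

/-- The 2-homomorphism of Lie triple 2-systems assigned to a 2-homomorphism of 2-term homotopy Lie
triple systems. -/
def TwoHom.toLT2 (h2 : (2 : k) ≠ 0) {X Y : HLTS.{w, u} k} {φ ψ : Hom X Y} (σ : TwoHom φ ψ) :
    LT2.TwoHom (φ.toLT2 h2) (ψ.toLT2 h2) where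
  θ := TMap₂ σ
  s_θ _ := rfl
  t_θ x := by
    change φ.φ₀ x + Y.d (σ.τ x) = ψ.φ₀ x
    rw [σ.d_τ, add_sub_cancel]
  nat P := by
    obtain ⟨x, f⟩ := P
    have h := σ.τ_d f
    have hx := σ.d_τ x
    rw [eq_sub_iff_add_eq] at h hx
    have hf : φ.φ₀ x + Y.d (φ.φ₁ f) = φ.φ₀ (x + X.d f) := by rw [map_add, φ.chain]
    rw [TwoVect.commutes₂₂]
    change φ.φ₀ x + Y.d (φ.φ₁ f) = φ.φ₀ (x + X.d f) ∧ φ.φ₀ x + Y.d (σ.τ x) = ψ.φ₀ x ∧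
      ((φ.φ₀ x, φ.φ₁ f) : Y.X₀ × Y.X₁) + (φ.φ₀ (x + X.d f), σ.τ (x + X.d f))
        - (φ.φ₀ x + Y.d (φ.φ₁ f), 0) =
      ((φ.φ₀ x, σ.τ x) : Y.X₀ × Y.X₁) + (ψ.φ₀ x, ψ.φ₁ f) - (φ.φ₀ x + Y.d (σ.τ x), 0)
    rw [add_comm] at hx
    rw [hf, hx, map_add σ.τ, ← h]
    refine ⟨rfl, rfl, ?_⟩
    simp only [Prod.mk_add_mk, Prod.mk_sub_mk, add_sub_cancel_right, sub_zero]
    congr 1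
    abel
  coh x y z := by
    have h := σ.arrBr_nat x y z
    have hs : Y.br (φ.φ₀ x) (φ.φ₀ y) (φ.φ₀ z) + Y.d (φ.φ₂ x y z) = φ.φ₀ (X.br x y z) := by
      rw [φ.d_φ₂, add_sub_cancel]
    have ht : ∀ x, φ.φ₀ x + Y.d (σ.τ x) = ψ.φ₀ x := fun x => by rw [σ.d_τ, add_sub_cancel]
    rw [TwoVect.commutes₂₂]
    change Y.br (φ.φ₀ x) (φ.φ₀ y) (φ.φ₀ z) + Y.d (φ.φ₂ x y z) = φ.φ₀ (X.br x y z) ∧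
      (TObj Y.toHLTSData).t ((TObj Y.toHLTSData).br₁ (φ.φ₀ x, σ.τ x) (φ.φ₀ y, σ.τ y)
        (φ.φ₀ z, σ.τ z)) = Y.br (ψ.φ₀ x) (ψ.φ₀ y) (ψ.φ₀ z) ∧
      ((Y.br (φ.φ₀ x) (φ.φ₀ y) (φ.φ₀ z), φ.φ₂ x y z) : Y.X₀ × Y.X₁) +
      (φ.φ₀ (X.br x y z), σ.τ (X.br x y z))
      - (Y.br (φ.φ₀ x) (φ.φ₀ y) (φ.φ₀ z) + Y.d (φ.φ₂ x y z), 0) =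
      (TObj Y.toHLTSData).br₁ (φ.φ₀ x, σ.τ x) (φ.φ₀ y, σ.τ y) (φ.φ₀ z, σ.τ z) +
      ((Y.br (ψ.φ₀ x) (ψ.φ₀ y) (ψ.φ₀ z), ψ.φ₂ x y z) : Y.X₀ × Y.X₁) -
      ((TObj Y.toHLTSData).t ((TObj Y.toHLTSData).br₁ (φ.φ₀ x, σ.τ x) (φ.φ₀ y, σ.τ y)
        (φ.φ₀ z, σ.τ z)), 0)
    rw [TObj_t_br, TObj_br₁, hs, ht, ht, ht]
    refine ⟨rfl, rfl, ?_⟩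
    simp only [Prod.mk_add_mk, Prod.mk_sub_mk, add_sub_cancel_right, sub_zero]
    rw [h]

end HLTS

/-! ### From Lie triple 2-systems to 2-term homotopy Lie triple systems -/

theorem TwoVect.coe_arrow (V : TwoVect.{w, u} k) (f : V.Mor) :
    (V.arrow f : V.Mor) = f - V.one (V.s f) := rfl

namespace LT2

variable (L : LT2.{w, u} k)

theorem br₀_skew (x y z) : L.br₀ x y z = -L.br₀ y x z := by
  have h := L.br₀_alt (x + y) z
  simp only [map_add, LinearMap.add_apply, L.br₀_alt, zero_add, add_zero] at h
  exact eq_neg_of_add_eq_zero_right h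

theorem br₁_skew (x y z) : L.br₁ x y z = -L.br₁ y x z := by
  have h := L.br₁_alt (x + y) z
  simp only [map_add, LinearMap.add_apply, L.br₁_alt, zero_add, add_zero] at h
  exact eq_neg_of_add_eq_zero_right h

/-- Factor `f` as `f` then `1_{t f}`, and `g` as `0` then `g`, possible because `s g = 0`. By
functoriality `{f, g, 1_x}` is `{f, 0, 1_x} = 0` followed by `{1_{t f}, g, 1_x}`. The companion
lemmas vary which slots receive which factorization. -/
theorem br₁_one_left (f g : L.Mor) (x : L.Ob) (hg : L.s g = 0) :
    L.br₁ (L.one (L.t f)) g (L.one x) = L.br₁ f g (L.one x) := by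
  have h := ((L.commutes₂₁ _ _ _).1 (L.br_comp f (L.one (L.t f)) 0 g (L.one x) (L.one x)
    (L.s_one _).symm (by rw [hg, map_zero]) (by rw [L.s_one, L.t_one]))).2
  simpa only [L.cmp_eq, L.t_one, map_zero, LinearMap.zero_apply, zero_add, sub_zero,
    add_sub_cancel_right] using h

theorem br₁_one_middle (f g : L.Mor) (x : L.Ob) (hf : L.s f = 0) :
    L.br₁ f (L.one (L.t g)) (L.one x) = L.br₁ f g (L.one x) := by
  have h := ((L.commutes₂₁ _ _ _).1 (L.br_comp 0 f g (L.one (L.t g)) (L.one x) (L.one x)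
    (by rw [hf, map_zero]) (L.s_one _).symm (by rw [L.s_one, L.t_one]))).2
  simpa only [L.cmp_eq, L.t_one, map_zero, LinearMap.zero_apply, zero_add, sub_zero,
    add_sub_cancel_right] using h

theorem br₁_one_one (f g h : L.Mor) (hh : L.s h = 0) :
    L.br₁ (L.one (L.t f)) (L.one (L.t g)) h = L.br₁ f g h := by
  have h := ((L.commutes₂₁ _ _ _).1 (L.br_comp f (L.one (L.t f)) g (L.one (L.t g)) 0 h
    (L.s_one _).symm (L.s_one _).symm (by rw [hh, map_zero]))).2
  simpa only [L.cmp_eq, L.t_one, map_zero, LinearMap.zero_apply, zero_add, sub_zero,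
    add_sub_cancel_right] using h

theorem br₁_one_left' (f g : L.Mor) (x : L.Ob) (hg : L.s g = 0) :
    L.br₁ (L.one (L.t f)) (L.one x) g = L.br₁ f (L.one x) g := by
  simpa only [L.t_one] using L.br₁_one_one f (L.one x) g hg

theorem br₁_one_middle' (f g : L.Mor) (x : L.Ob) (hg : L.s g = 0) :
    L.br₁ (L.one x) (L.one (L.t f)) g = L.br₁ (L.one x) f g := by
  simpa only [L.t_one] using L.br₁_one_one (L.one x) f g hg

theorem br₁_one_right (f g : L.Mor) (x : L.Ob) (hf : L.s f = 0) :
    L.br₁ f (L.one x) (L.one (L.t g)) = L.br₁ f (L.one x) g := by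
  have h := ((L.commutes₂₁ _ _ _).1 (L.br_comp 0 f (L.one x) (L.one x) g (L.one (L.t g))
    (by rw [hf, map_zero]) (by rw [L.s_one, L.t_one]) (L.s_one _).symm)).2
  simpa only [L.cmp_eq, L.t_one, map_zero, LinearMap.zero_apply, zero_add, sub_zero,
    add_sub_cancel_right] using h

/-- The left side is the arrow part of the fundamentor at the targets. If one `fᵢ` lies in `ker s`
and the others are identities, the terms at the sources vanish by multilinearity, and the conditions
on `J(…, df, …)` remain. -/
theorem Jac_nat_eq (f₁ f₂ f₃ f₄ f₅ : L.Mor) : L.Jac (L.t f₁) (L.t f₂) (L.t f₃) (L.t f₄) (L.t f₅)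
      - L.one (L.br₀ (L.t f₁) (L.t f₂) (L.br₀ (L.t f₃) (L.t f₄) (L.t f₅))) =
    L.Jac (L.s f₁) (L.s f₂) (L.s f₃) (L.s f₄) (L.s f₅)
      - L.one (L.t (L.Jac (L.s f₁) (L.s f₂) (L.s f₃) (L.s f₄) (L.s f₅)))
      + (L.br₁ (L.br₁ f₁ f₂ f₃) f₄ f₅ + L.br₁ f₃ (L.br₁ f₁ f₂ f₄) f₅
        + L.br₁ f₃ f₄ (L.br₁ f₁ f₂ f₅)) - L.br₁ f₁ f₂ (L.br₁ f₃ f₄ f₅) := by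
  have h := ((L.commutes₂₂ _ _ _ _).1 (L.Jac_nat f₁ f₂ f₃ f₄ f₅)).2.2
  simp only [L.t_br] at h
  linear_combination (norm := abel) h

/-- The 2-term homotopy Lie triple system assigned to a Lie triple 2-system. -/
abbrev toHLTS (L : LT2.{w, u} k) : HLTS.{w, u} k where
  toHLTSData := SObj L
  d_brR x y f := by simp [L.t_br, L.t_one]
  d_brM x f y := by simp [L.t_br, L.t_one]
  -- Both sides of this relation equal `{f, g, 1_x}`; in the next one involving `d`, both equal `{f,
  -- 1_x, g}`.
  brM_d f g x := Subtype.ext ((L.br₁_one_left f g x g.2).trans (L.br₁_one_middle f g x f.2).symm)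
  brR_d f x g := Subtype.ext ((L.br₁_one_left' f g x g.2).trans (L.br₁_one_right f g x f.2).symm)
  br_skew := L.br₀_skew
  brR_skew x y f := Subtype.ext (L.br₁_skew _ _ _)
  brM_skew x f y := Subtype.ext (L.br₁_skew _ _ _)
  br_cyc := L.br₀_cyc
  brR_cyc x y f := Subtype.ext (L.br₁_cyc _ _ _)
  J_alt x₁ x₂ x y := by simp [L.Jac_alt]
  J_cyc x₁ x₂ x y z := by
    simp only [pentalin_apply, ← map_add, L.Jac_cyc, map_zero]
  d_J x₁ x₂ x₃ x₄ x₅ := by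
    simp [TwoVect.coe_arrow, L.s_Jac, L.t_Jac, L.t_one]
    abel
  J_d₁ f x₂ x₃ x₄ x₅ := Subtype.ext (by
    have h := L.Jac_nat_eq f (L.one x₂) (L.one x₃) (L.one x₄) (L.one x₅)
    have hf : L.s f = 0 := f.2
    simp [L.t_one, L.s_one, hf, L.br_one] at h
    simp [TwoVect.coe_arrow, L.s_Jac, h]
    abel)
  J_d₂ x₁ f x₃ x₄ x₅ := Subtype.ext (by
    have h := L.Jac_nat_eq (L.one x₁) f (L.one x₃) (L.one x₄) (L.one x₅)
    have hf : L.s f = 0 := f.2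
    simp [L.t_one, L.s_one, hf, L.br_one] at h
    simp [TwoVect.coe_arrow, L.s_Jac, h]
    abel)
  J_d₃ x₁ x₂ f x₄ x₅ := Subtype.ext (by
    have h := L.Jac_nat_eq (L.one x₁) (L.one x₂) f (L.one x₄) (L.one x₅)
    have hf : L.s f = 0 := f.2
    simp [L.t_one, L.s_one, hf, L.br_one] at h
    simp [TwoVect.coe_arrow, L.s_Jac, h]
    abel)
  J_d₅ x₁ x₂ x₃ x₄ f := Subtype.ext (by
    have h := L.Jac_nat_eq (L.one x₁) (L.one x₂) (L.one x₃) (L.one x₄) f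
    have hf : L.s f = 0 := f.2
    simp [L.t_one, L.s_one, hf, L.br_one] at h
    simp [TwoVect.coe_arrow, L.s_Jac, h]
    abel)
  J_coh x₁ x₂ x₃ x₄ x₅ x₆ x₇ := Subtype.ext (by
    have h := ((L.commutes₄₃ _ _ _ _ _ _ _).1 (L.Jac_coh x₁ x₂ x₃ x₄ x₅ x₆ x₇)).2.2
    simp only [map_add, L.t_br, L.t_one, L.t_Jac] at h
    simp only [trilin_apply, pentalin_apply, Submodule.coe_add, TwoVect.coe_arrow, L.s_Jac,
      map_sub, LinearMap.sub_apply, L.br_one]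
    linear_combination (norm := abel) h)

/-- The homomorphism of 2-term homotopy Lie triple systems assigned to a homomorphism of Lie
triple 2-systems. -/
def Hom.toHLTS {L M : LT2.{w, u} k} (F : Hom L M) : HLTS.Hom L.toHLTS M.toHLTS where
  toHomData := SMap F
  chain h := (F.t_F₁ h).symm
  alt x y := by
    change M.arrow (F.F₂ x x y) = 0
    rw [F.alt, map_zero]
  cyc x y z := by
    change M.arrow (F.F₂ x y z) = -M.arrow (F.F₂ y z x) - M.arrow (F.F₂ z x y)
    rw [F.cyc, map_sub, map_neg]
  d_φ₂ x y z := by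
    change M.t (F.F₂ x y z - M.one (M.s (F.F₂ x y z))) = _
    rw [map_sub, M.t_one, F.s_F₂, F.t_F₂]
    rfl
  φ₂_R x y h := Subtype.ext (by
    have hh : L.s h = 0 := h.2
    have e := F.nat_eq (L.one x) (L.one y) h
    change F.F₂ x y (L.t h) - M.one (M.s (F.F₂ x y (L.t h))) =
      F.F₁ (L.br₁ (L.one x) (L.one y) h) - M.br₁ (M.one (F.F₀ x)) (M.one (F.F₀ y)) (F.F₁ h)
    simp only [hh, L.s_one, L.t_one, map_zero, F.F₁_one] at e
    rw [e, F.s_F₂]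
    abel)
  φ₂_M x h y := Subtype.ext (by
    have hh : L.s h = 0 := h.2
    have e := F.nat_eq (L.one x) h (L.one y)
    change F.F₂ x (L.t h) y - M.one (M.s (F.F₂ x (L.t h) y)) =
      F.F₁ (L.br₁ (L.one x) h (L.one y)) - M.br₁ (M.one (F.F₀ x)) (F.F₁ h) (M.one (F.F₀ y))
    simp only [hh, L.s_one, L.t_one, map_zero, LinearMap.zero_apply, F.F₁_one] at e
    rw [e, F.s_F₂]
    abel)
  coh x₁ x₂ x₃ x₄ x₅ := Subtype.ext (by
    have h := ((M.commutes₃₃ _ _ _ _ _ _).1 (F.coh x₁ x₂ x₃ x₄ x₅)).2.2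
    simp only [map_add, M.t_br, M.t_one, M.t_Jac, F.t_F₂] at h
    simp only [SMap, SMapφ₂, LinearMap.coe_restrict_apply, trilin_apply, pentalin_apply,
      Submodule.coe_add, TwoVect.coe_arrow, L.s_Jac, M.s_Jac, F.s_F₂, F.F₁_one,
      map_sub, LinearMap.sub_apply, M.br_one]
    linear_combination (norm := abel) h)

/-- The 2-homomorphism of 2-term homotopy Lie triple systems assigned to a 2-homomorphism of Lie
triple 2-systems. -/
def TwoHom.toHLTS {L M : LT2.{w, u} k} {F G : Hom L M} (σ : TwoHom F G) :
    HLTS.TwoHom F.toHLTS G.toHLTS where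
  τ := SMap₂ σ
  d_τ x := by
    change M.t (σ.θ x - M.one (M.s (σ.θ x))) = G.F₀ x - F.F₀ x
    rw [map_sub, M.t_one, σ.s_θ, σ.t_θ]
  τ_d h := Subtype.ext (by
    have hh : L.s h = 0 := h.2
    have e := σ.nat_eq h
    change σ.θ (L.t h) - M.one (M.s (σ.θ (L.t h))) = G.F₁ h - F.F₁ h
    rw [e, σ.s_θ, hh]
    simp only [map_zero]
    abel)
  coh x y z := Subtype.ext (by
    have h := ((M.commutes₂₂ _ _ _ _).1 (σ.coh x y z)).2.2
    have hs : ∀ x, M.s (σ.θ x - M.one (F.F₀ x)) = 0 := fun x => by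
      rw [map_sub, M.s_one, σ.s_θ, sub_self]
    have hθ : ∀ x, σ.θ x = M.one (F.F₀ x) + (σ.θ x - M.one (F.F₀ x)) := fun x => by abel
    change F.F₂ x y z - M.one (M.s (F.F₂ x y z)) - (G.F₂ x y z - M.one (M.s (G.F₂ x y z))) =
      M.br₁ (M.one (F.F₀ x)) (M.one (F.F₀ y)) (σ.θ z - M.one (M.s (σ.θ z)))
      + M.br₁ (M.one (F.F₀ x)) (σ.θ y - M.one (M.s (σ.θ y))) (M.one (F.F₀ z))
      + M.br₁ (σ.θ x - M.one (M.s (σ.θ x))) (M.one (F.F₀ y)) (M.one (F.F₀ z))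
      + M.br₁ (M.one (M.t (σ.θ x - M.one (M.s (σ.θ x))))) (σ.θ y - M.one (M.s (σ.θ y)))
          (M.one (F.F₀ z))
      + M.br₁ (M.one (M.t (σ.θ x - M.one (M.s (σ.θ x))))) (M.one (F.F₀ y))
          (σ.θ z - M.one (M.s (σ.θ z)))
      + M.br₁ (M.one (F.F₀ x)) (M.one (M.t (σ.θ y - M.one (M.s (σ.θ y)))))
          (σ.θ z - M.one (M.s (σ.θ z)))
      + M.br₁ (M.one (M.t (σ.θ x - M.one (M.s (σ.θ x)))))
          (M.one (M.t (σ.θ y - M.one (M.s (σ.θ y))))) (σ.θ z - M.one (M.s (σ.θ z)))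
      - (σ.θ (L.br₀ x y z) - M.one (M.s (σ.θ (L.br₀ x y z))))
    simp only [M.t_br, F.t_F₂, σ.t_θ] at h
    simp only [σ.s_θ, F.s_F₂, G.s_F₂]
    -- With `τ = θ - 1`, each identity at `dτ` may be replaced by `τ` itself; the seven bracket
    -- terms then sum to `{θ_x, θ_y, θ_z}` minus the bracket of identities.
    rw [M.br₁_one_left _ _ _ (hs y), M.br₁_one_left' _ _ _ (hs z), M.br₁_one_middle' _ _ _ (hs z),
      M.br₁_one_one _ _ _ (hs z)]
    simp only [map_sub, LinearMap.sub_apply, M.br_one]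
    linear_combination (norm := abel) h)

theorem eqToHom_θ {A B : LT2.{w, u} k} {F G : Hom A B} (h : F = G) (x : A.Ob) :
    TwoHom.θ (eqToHom h) x = B.one (F.F₀ x) := by
  subst h; rfl

end LT2

/-! ### The strict 2-functor `T` -/

/-- Composing a 2-morphism on both sides with equality 2-cells adds and removes identities; this is
the resulting cancellation. -/
theorem eq_add_add_sub_sub {M : Type*} [AddCommGroup M] (a b c : M) :
    a = b + (a + c - c) - b := by abel

namespace HLTS

theorem eqToHom_comp_eqToHom_τ {A B : HLTS.{w, u} k} {φ φ' ψ ψ' : Hom A B} (h : φ = φ')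
    (σ : φ' ⟶ ψ') (h' : ψ' = ψ) :
    TwoHom.τ (eqToHom h ≫ σ ≫ eqToHom h') = TwoHom.τ σ := by
  rw [comp_τ, comp_τ, eqToHom_τ, eqToHom_τ, zero_add, add_zero]

theorem Hom.toLT2_id (h2 : (2 : k) ≠ 0) (X : HLTS.{w, u} k) :
    (Hom.id X).toLT2 h2 = LT2.Hom.id (X.toLT2 h2) :=
  LT2.Hom.ext_apply rfl rfl fun _ _ _ => rfl

theorem Hom.toLT2_comp (h2 : (2 : k) ≠ 0) {X Y Z : HLTS.{w, u} k} (φ : Hom X Y) (ψ : Hom Y Z) :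
    (φ.comp ψ).toLT2 h2 = (φ.toLT2 h2).comp (ψ.toLT2 h2) :=
  LT2.Hom.ext_apply rfl rfl fun x y z => by
    rw [LT2.Hom.comp_F₂]
    change ((Z.br (ψ.φ₀ (φ.φ₀ x)) (ψ.φ₀ (φ.φ₀ y)) (ψ.φ₀ (φ.φ₀ z)),
        ψ.φ₂ (φ.φ₀ x) (φ.φ₀ y) (φ.φ₀ z) + ψ.φ₁ (φ.φ₂ x y z)) : Z.X₀ × Z.X₁) =
      (Z.br (ψ.φ₀ (φ.φ₀ x)) (ψ.φ₀ (φ.φ₀ y)) (ψ.φ₀ (φ.φ₀ z)), ψ.φ₂ (φ.φ₀ x) (φ.φ₀ y) (φ.φ₀ z))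
      + (ψ.φ₀ (Y.br (φ.φ₀ x) (φ.φ₀ y) (φ.φ₀ z)), ψ.φ₁ (φ.φ₂ x y z))
      - (ψ.φ₀ (Y.br (φ.φ₀ x) (φ.φ₀ y) (φ.φ₀ z)), 0)
    simp only [Prod.mk_add_mk, Prod.mk_sub_mk, add_sub_cancel_right, sub_zero]

theorem TwoHom.toLT2_id (h2 : (2 : k) ≠ 0) {X Y : HLTS.{w, u} k} (φ : Hom X Y) :
    (TwoHom.id φ).toLT2 h2 = LT2.TwoHom.id (φ.toLT2 h2) :=
  rfl

/-- Composition in `T(Y)` keeps the source and adds arrow parts, so it is by definition the sum of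
homotopies. -/
theorem TwoHom.toLT2_vcomp (h2 : (2 : k) ≠ 0) {X Y : HLTS.{w, u} k} {φ ψ χ : Hom X Y}
    (σ : TwoHom φ ψ) (τ : TwoHom ψ χ) :
    (σ.vcomp τ).toLT2 h2 = (σ.toLT2 h2).vcomp (τ.toLT2 h2) :=
  rfl

/-- The strict 2-functor from 2-term homotopy Lie triple systems to Lie triple 2-systems. -/
def toLT2Functor (h2 : (2 : k) ≠ 0) : StrictPseudofunctor (HLTS.{w, u} k) (LT2.{w, u} k) :=
  StrictPseudofunctor.mk''
    { obj := fun X => X.toLT2 h2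
      map := fun φ => Hom.toLT2 h2 φ
      map₂ := fun σ => TwoHom.toLT2 h2 σ
      map₂_id := fun φ => TwoHom.toLT2_id h2 φ
      map₂_comp := fun σ τ => TwoHom.toLT2_vcomp h2 σ τ
      map_id := fun X => Hom.toLT2_id h2 X
      map_comp := fun φ ψ => Hom.toLT2_comp h2 φ ψ
      map₂_whisker_left := fun {X Y Z} φ {ψ χ} σ => LT2.twoHom_ext fun x => by
        rw [LT2.comp_θ, LT2.comp_θ, LT2.eqToHom_θ, LT2.eqToHom_θ]
        exact eq_add_add_sub_sub _ _ _
      map₂_whisker_right := fun {X Y Z φ ψ} σ χ => LT2.twoHom_ext fun x => by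
        rw [LT2.comp_θ, LT2.comp_θ, LT2.eqToHom_θ, LT2.eqToHom_θ]
        exact eq_add_add_sub_sub _ _ _ }

theorem isExplicitT (h2 : (2 : k) ≠ 0) : IsExplicitT (toLT2Functor.{w, u} h2) where
  obj _ := rfl
  map _ := HEq.rfl
  map₂ _ := HEq.rfl

end HLTS

/-! ### The strict 2-functor `S` -/

namespace LT2

theorem Hom.toHLTS_id (L : LT2.{w, u} k) : (Hom.id L).toHLTS = HLTS.Hom.id L.toHLTS :=
  HLTS.Hom.ext_data (HLTS.HomData.ext rfl rfl (by
    ext x y z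
    change L.one (L.br₀ x y z) - L.one (L.s (L.one (L.br₀ x y z))) = 0
    rw [L.s_one, sub_self]))

theorem Hom.toHLTS_comp {L M N : LT2.{w, u} k} (F : Hom L M) (G : Hom M N) :
    (F.comp G).toHLTS = F.toHLTS.comp G.toHLTS :=
  HLTS.Hom.ext_data (HLTS.HomData.ext rfl rfl (by
    ext x y z
    change (F.comp G).F₂ x y z - N.one (N.s ((F.comp G).F₂ x y z)) =
      (G.F₂ (F.F₀ x) (F.F₀ y) (F.F₀ z) - N.one (N.s (G.F₂ (F.F₀ x) (F.F₀ y) (F.F₀ z))))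
      + G.F₁ (F.F₂ x y z - M.one (M.s (F.F₂ x y z)))
    -- The identity at the intermediate object, subtracted in the composite, is the one that `G₁`
    -- produces from the identity part of `F₂`.
    rw [(F.comp G).s_F₂, Hom.comp_F₂, G.s_F₂, F.s_F₂, map_sub, G.F₁_one]
    simp only [Hom.comp_F₀]
    abel))

theorem TwoHom.toHLTS_id {L M : LT2.{w, u} k} (F : Hom L M) :
    (TwoHom.id F).toHLTS = HLTS.TwoHom.id F.toHLTS :=
  HLTS.TwoHom.ext (LinearMap.ext fun x => Subtype.ext (by
    change M.one (F.F₀ x) - M.one (M.s (M.one (F.F₀ x))) = 0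
    rw [M.s_one, sub_self]))

theorem TwoHom.toHLTS_vcomp {L M : LT2.{w, u} k} {F G H : Hom L M} (σ : TwoHom F G)
    (τ : TwoHom G H) : (σ.vcomp τ).toHLTS = σ.toHLTS.vcomp τ.toHLTS :=
  HLTS.TwoHom.ext (LinearMap.ext fun x => Subtype.ext (by
    have h : (σ.vcomp τ).θ x = _ := M.cmp_eq _ _ _
    change (σ.vcomp τ).θ x - M.one (M.s ((σ.vcomp τ).θ x)) =
      (σ.θ x - M.one (M.s (σ.θ x))) + (τ.θ x - M.one (M.s (τ.θ x)))
    rw [(σ.vcomp τ).s_θ, h, σ.s_θ, σ.t_θ, τ.s_θ]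
    abel))

theorem TwoHom.whiskerLeft_toHLTS_τ {L M N : LT2.{w, u} k} (F : Hom L M) {G H : Hom M N}
    (σ : TwoHom G H) :
    (TwoHom.whiskerLeft F σ).toHLTS.τ = (HLTS.TwoHom.whiskerLeft F.toHLTS σ.toHLTS).τ :=
  rfl

/-- `H₁` respects sources and identities, hence commutes with taking arrow parts. -/
theorem TwoHom.whiskerRight_toHLTS_τ {L M N : LT2.{w, u} k} {F G : Hom L M} (σ : TwoHom F G)
    (H : Hom M N) :
    (TwoHom.whiskerRight σ H).toHLTS.τ = (HLTS.TwoHom.whiskerRight σ.toHLTS H.toHLTS).τ := by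
  refine LinearMap.ext fun x => Subtype.ext ?_
  change H.F₁ (σ.θ x) - N.one (N.s (H.F₁ (σ.θ x))) = H.F₁ (σ.θ x - M.one (M.s (σ.θ x)))
  rw [map_sub, H.F₁_one, H.s_F₁]

theorem TwoHom.whiskerLeft_toHLTS {L M N : LT2.{w, u} k} (F : Hom L M) {G H : Hom M N}
    (σ : TwoHom G H) : ((TwoHom.whiskerLeft F σ).toHLTS : (F.comp G).toHLTS ⟶ (F.comp H).toHLTS) =
      eqToHom (Hom.toHLTS_comp F G) ≫ (HLTS.TwoHom.whiskerLeft F.toHLTS σ.toHLTS :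
        F.toHLTS.comp G.toHLTS ⟶ F.toHLTS.comp H.toHLTS) ≫ eqToHom (Hom.toHLTS_comp F H).symm :=
  HLTS.twoHom_ext ((TwoHom.whiskerLeft_toHLTS_τ F σ).trans (HLTS.eqToHom_comp_eqToHom_τ _ _ _).symm)

theorem TwoHom.whiskerRight_toHLTS {L M N : LT2.{w, u} k} {F G : Hom L M} (σ : TwoHom F G)
    (H : Hom M N) : ((TwoHom.whiskerRight σ H).toHLTS : (F.comp H).toHLTS ⟶ (G.comp H).toHLTS) =
      eqToHom (Hom.toHLTS_comp F H) ≫ (HLTS.TwoHom.whiskerRight σ.toHLTS H.toHLTS :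
        F.toHLTS.comp H.toHLTS ⟶ G.toHLTS.comp H.toHLTS) ≫ eqToHom (Hom.toHLTS_comp G H).symm :=
  HLTS.twoHom_ext ((TwoHom.whiskerRight_toHLTS_τ σ H).trans
    (HLTS.eqToHom_comp_eqToHom_τ _ _ _).symm)

/-- The strict 2-functor from Lie triple 2-systems to 2-term homotopy Lie triple systems. -/
def toHLTSFunctor : StrictPseudofunctor (LT2.{w, u} k) (HLTS.{w, u} k) :=
  StrictPseudofunctor.mk''
    { obj := fun L => L.toHLTS
      map := fun F => Hom.toHLTS F
      map₂ := fun σ => TwoHom.toHLTS σ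
      map₂_id := fun F => TwoHom.toHLTS_id F
      map₂_comp := fun σ τ => TwoHom.toHLTS_vcomp σ τ
      map_id := fun L => Hom.toHLTS_id L
      map_comp := fun F G => Hom.toHLTS_comp F G
      map₂_whisker_left := fun F _ _ σ => TwoHom.whiskerLeft_toHLTS F σ
      map₂_whisker_right := fun σ H => TwoHom.whiskerRight_toHLTS σ H }

theorem isExplicitS : IsExplicitS (toHLTSFunctor.{w, u} (k := k)) where
  obj _ := rfl
  map _ := HEq.rfl
  map₂ _ := HEq.rfl

/-! ### The 2-natural isomorphism `TS ≅ 1` -/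

/-- A homomorphism of Lie triple 2-systems from a linear functor that preserves the brackets and
the fundamentor strictly. -/
def Hom.ofStrict {A B : LT2.{w, u} k} (F₀ : A.Ob →ₗ[k] B.Ob) (F₁ : A.Mor →ₗ[k] B.Mor)
    (hs : ∀ f, B.s (F₁ f) = F₀ (A.s f)) (ht : ∀ f, B.t (F₁ f) = F₀ (A.t f))
    (h₁ : ∀ x, F₁ (A.one x) = B.one (F₀ x))
    (hb₀ : ∀ x y z, F₀ (A.br₀ x y z) = B.br₀ (F₀ x) (F₀ y) (F₀ z))
    (hb₁ : ∀ f g h, F₁ (A.br₁ f g h) = B.br₁ (F₁ f) (F₁ g) (F₁ h))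
    (hJ : ∀ x₁ x₂ x₃ x₄ x₅, F₁ (A.Jac x₁ x₂ x₃ x₄ x₅) =
      B.Jac (F₀ x₁) (F₀ x₂) (F₀ x₃) (F₀ x₄) (F₀ x₅)) : Hom A B where
  F₀ := F₀
  F₁ := F₁
  F₂ := trilin (fun x y z => B.one (B.br₀ (F₀ x) (F₀ y) (F₀ z))) (by simp) (by simp) (by simp)
    (by simp) (by simp) (by simp)
  s_F₁ := hs
  t_F₁ := ht
  F₁_one := h₁
  F₁_comp f g h := by
    rw [B.commutes₂₁, A.cmp_eq, hs, ht, h, map_sub, map_add, h₁]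
    exact ⟨rfl, rfl⟩
  s_F₂ _ _ _ := B.s_one _
  t_F₂ x y z := (B.t_one _).trans (hb₀ x y z).symm
  F₂_nat f g h := by
    rw [B.commutes₂₂]
    simp [B.t_br, B.s_br, B.s_one, B.t_one, hs, ht, hb₁]
  alt x y := by simp [B.br₀_alt]
  cyc x y z := by
    have h := congrArg B.one (B.br₀_cyc (F₀ x) (F₀ y) (F₀ z))
    simp only [map_add, map_zero] at h
    simp only [trilin_apply]
    linear_combination (norm := abel) h
  coh x₁ x₂ x₃ x₄ x₅ := by
    rw [B.commutes₃₃]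
    simp [B.s_one, B.t_one, B.s_Jac, B.t_Jac, hb₀, hJ, B.br_one]

/-- The map `(x, f) ↦ 1_x + f`. -/
def ofArrow (L : LT2.{w, u} k) : L.Ob × LinearMap.ker L.s →ₗ[k] L.Mor :=
  LinearMap.coprod L.one (LinearMap.ker L.s).subtype

theorem ofArrow_apply (L : LT2.{w, u} k) (x f) : L.ofArrow (x, f) = L.one x + f := by
  simp [ofArrow]

/-- The map `f ↦ (s f, f - 1_{s f})`. -/
def toArrow (L : LT2.{w, u} k) : L.Mor →ₗ[k] L.Ob × LinearMap.ker L.s :=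
  LinearMap.prod L.s L.arrow

theorem toArrow_apply (L : LT2.{w, u} k) (f) : L.toArrow f = (L.s f, L.arrow f) := rfl

theorem ofArrow_toArrow (L : LT2.{w, u} k) (f) : L.ofArrow (L.toArrow f) = f := by
  rw [toArrow_apply, ofArrow_apply, TwoVect.coe_arrow, add_sub_cancel]

theorem toArrow_ofArrow (L : LT2.{w, u} k) (P) : L.toArrow (L.ofArrow P) = P := by
  obtain ⟨x, f⟩ := P
  have hf : L.s f = 0 := f.2
  rw [ofArrow_apply, toArrow_apply]
  refine Prod.ext ?_ (Subtype.ext ?_)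
  · simp [L.s_one, hf]
  · simp [TwoVect.coe_arrow, L.s_one, hf]

/-- Expand `{1_x + f, 1_y + g, 1_z + h}` into eight terms: one is an identity, and the `br₁_one`
lemmas match the other seven with the summands defining the bracket of `T`. -/
theorem ofArrow_br₁ (L : LT2.{w, u} k) (P Q R) : L.ofArrow ((TObj (SObj L)).br₁ P Q R) =
    L.br₁ (L.ofArrow P) (L.ofArrow Q) (L.ofArrow R) := by
  obtain ⟨x, f⟩ := P
  obtain ⟨y, g⟩ := Q
  obtain ⟨z, h⟩ := R
  have hf : L.s f = 0 := f.2
  have hg : L.s g = 0 := g.2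
  have hh : L.s h = 0 := h.2
  simp only [trilin_apply, ofArrow_apply, Submodule.coe_add, map_add, LinearMap.add_apply,
    LinearMap.comp_apply, Submodule.subtype_apply, L.br_one, L.br₁_one_one _ _ _ hh,
    L.br₁_one_left _ _ _ hg, L.br₁_one_left' _ _ _ hh, L.br₁_one_middle' _ _ _ hh]
  abel

/-- The isomorphism from `TS(L)` to `L`. -/
def fromTS (h2 : (2 : k) ≠ 0) (L : LT2.{w, u} k) : Hom (L.toHLTS.toLT2 h2) L :=
  Hom.ofStrict LinearMap.id L.ofArrow
    (fun P => by
      have hf : L.s P.2 = 0 := P.2.2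
      change L.s (L.ofArrow (P.1, P.2)) = P.1
      rw [ofArrow_apply, map_add, L.s_one, hf, add_zero])
    (fun P => by
      change L.t (L.ofArrow (P.1, P.2)) = P.1 + L.t P.2
      rw [ofArrow_apply, map_add, L.t_one])
    (fun x => by
      change L.ofArrow (x, 0) = L.one x
      rw [ofArrow_apply]
      exact add_zero _)
    (fun _ _ _ => rfl)
    L.ofArrow_br₁
    (fun x₁ x₂ x₃ x₄ x₅ => by
      change L.ofArrow (L.br₀ x₁ x₂ (L.br₀ x₃ x₄ x₅), L.arrow (L.Jac x₁ x₂ x₃ x₄ x₅)) =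
        L.Jac x₁ x₂ x₃ x₄ x₅
      rw [ofArrow_apply, TwoVect.coe_arrow, L.s_Jac, add_sub_cancel])

/-- The isomorphism from `L` to `TS(L)`. -/
def toTS (h2 : (2 : k) ≠ 0) (L : LT2.{w, u} k) : Hom L (L.toHLTS.toLT2 h2) :=
  Hom.ofStrict LinearMap.id L.toArrow
    (fun _ => rfl)
    (fun f => by
      change L.s f + L.t (f - L.one (L.s f)) = L.t f
      rw [map_sub, L.t_one, add_sub_cancel])
    (fun x => by
      refine Prod.ext (L.s_one x) (Subtype.ext ?_)
      change L.one x - L.one (L.s (L.one x)) = 0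
      rw [L.s_one, sub_self])
    (fun _ _ _ => rfl)
    (fun f g h => by
      -- The inverse of a bijection preserving the bracket preserves it too.
      have e := L.ofArrow_br₁ (L.toArrow f) (L.toArrow g) (L.toArrow h)
      rw [ofArrow_toArrow, ofArrow_toArrow, ofArrow_toArrow] at e
      rw [← e, toArrow_ofArrow])
    (fun x₁ x₂ x₃ x₄ x₅ => Prod.ext (L.s_Jac x₁ x₂ x₃ x₄ x₅) rfl)

theorem toTS_comp_fromTS (h2 : (2 : k) ≠ 0) (L : LT2.{w, u} k) :
    (L.toTS h2).comp (L.fromTS h2) = Hom.id L :=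
  Hom.ext_apply rfl (LinearMap.ext L.ofArrow_toArrow) fun x y z => by
    rw [Hom.comp_F₂]
    change L.one (L.br₀ x y z) + L.ofArrow (L.br₀ x y z, 0) - L.one (L.br₀ x y z) =
      L.one (L.br₀ x y z)
    rw [ofArrow_apply, add_sub_cancel_left]
    exact add_zero _

theorem fromTS_comp_toTS (h2 : (2 : k) ≠ 0) (L : LT2.{w, u} k) :
    (L.fromTS h2).comp (L.toTS h2) = Hom.id (L.toHLTS.toLT2 h2) :=
  Hom.ext_apply rfl (LinearMap.ext L.toArrow_ofArrow) fun x y z => by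
    rw [Hom.comp_F₂]
    change (L.br₀ x y z, (0 : LinearMap.ker L.s)) + L.toArrow (L.one (L.br₀ x y z))
      - (L.br₀ x y z, 0) = (L.br₀ x y z, 0)
    rw [add_sub_cancel_left]
    refine Prod.ext (L.s_one _) (Subtype.ext ?_)
    change L.one (L.br₀ x y z) - L.one (L.s (L.one (L.br₀ x y z))) = 0
    rw [L.s_one, sub_self]

theorem fromTS_naturality (h2 : (2 : k) ≠ 0) {L M : LT2.{w, u} k} (F : Hom L M) :
    (F.toHLTS.toLT2 h2).comp (M.fromTS h2) = (L.fromTS h2).comp F :=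
  Hom.ext_apply rfl
    (LinearMap.ext fun P => by
      obtain ⟨x, f⟩ := P
      change M.ofArrow (F.F₀ x, F.toHLTS.φ₁ f) = F.F₁ (L.ofArrow (x, f))
      rw [ofArrow_apply, ofArrow_apply, map_add, F.F₁_one]
      rfl)
    fun x y z => by
      rw [Hom.comp_F₂, Hom.comp_F₂]
      -- The structure maps of `fromTS` are identities and cancel; what remains is that `F₂` is the
      -- sum of the identity at its source and its arrow part.
      change M.one (M.br₀ (F.F₀ x) (F.F₀ y) (F.F₀ z)) +
          M.ofArrow (M.br₀ (F.F₀ x) (F.F₀ y) (F.F₀ z), M.arrow (F.F₂ x y z)) -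
          M.one (M.br₀ (F.F₀ x) (F.F₀ y) (F.F₀ z)) =
        F.F₂ x y z + F.F₁ (L.one (L.br₀ x y z)) - M.one (F.F₀ (L.br₀ x y z))
      rw [ofArrow_apply, TwoVect.coe_arrow, F.s_F₂, F.F₁_one]
      abel

theorem eqToHom_comp_θ {A B : LT2.{w, u} k} {F G H : Hom A B} (h : F = G) (σ : G ⟶ H) (x : A.Ob) :
    TwoHom.θ (eqToHom h ≫ σ) x = TwoHom.θ σ x := by
  subst h
  rw [eqToHom_refl, Category.id_comp]

theorem comp_eqToHom_θ {A B : LT2.{w, u} k} {F G H : Hom A B} (σ : F ⟶ G) (h : G = H) (x : A.Ob) :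
    TwoHom.θ (σ ≫ eqToHom h) x = TwoHom.θ σ x := by
  subst h
  rw [eqToHom_refl, Category.comp_id]

theorem fromTS_naturality₂_θ (h2 : (2 : k) ≠ 0) {L M : LT2.{w, u} k} {F G : Hom L M}
    (σ : TwoHom F G) (x : L.Ob) :
    (TwoHom.whiskerRight (σ.toHLTS.toLT2 h2) (M.fromTS h2)).θ x =
      (TwoHom.whiskerLeft (L.fromTS h2) σ).θ x := by
  change M.ofArrow (F.F₀ x, M.arrow (σ.θ x)) = σ.θ x
  rw [ofArrow_apply, TwoVect.coe_arrow, σ.s_θ, add_sub_cancel]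

/-- The 2-natural isomorphism from `TS` to the identity. -/
def fromTSIso (h2 : (2 : k) ≠ 0) : TwoNatIso
    (toHLTSFunctor.comp (HLTS.toLT2Functor h2)) (StrictPseudofunctor.id (LT2.{w, u} k)) where
  app L := L.fromTS h2
  inv L := L.toTS h2
  app_inv L := L.fromTS_comp_toTS h2
  inv_app L := L.toTS_comp_fromTS h2
  naturality F := fromTS_naturality h2 F
  naturality₂ σ := twoHom_ext fun x => (comp_eqToHom_θ _ _ x).trans
    ((fromTS_naturality₂_θ h2 σ x).trans (eqToHom_comp_θ _ _ x).symm)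

end LT2

/-! ### The 2-natural isomorphism `ST ≅ 1` -/

namespace HLTS

/-- A homomorphism of 2-term homotopy Lie triple systems from a chain map that preserves the
brackets and `J` strictly. -/
def Hom.ofStrict {A B : HLTS.{w, u} k} (φ₀ : A.X₀ →ₗ[k] B.X₀) (φ₁ : A.X₁ →ₗ[k] B.X₁)
    (hd : ∀ h, φ₀ (A.d h) = B.d (φ₁ h))
    (hb : ∀ x y z, φ₀ (A.br x y z) = B.br (φ₀ x) (φ₀ y) (φ₀ z))
    (hM : ∀ x f y, φ₁ (A.brM x f y) = B.brM (φ₀ x) (φ₁ f) (φ₀ y))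
    (hR : ∀ x y f, φ₁ (A.brR x y f) = B.brR (φ₀ x) (φ₀ y) (φ₁ f))
    (hJ : ∀ x₁ x₂ x₃ x₄ x₅, φ₁ (A.J x₁ x₂ x₃ x₄ x₅) =
      B.J (φ₀ x₁) (φ₀ x₂) (φ₀ x₃) (φ₀ x₄) (φ₀ x₅)) : Hom A B where
  φ₀ := φ₀
  φ₁ := φ₁
  φ₂ := 0
  chain := hd
  alt := by simp
  cyc := by simp
  d_φ₂ := by simp [hb]
  φ₂_R := by simp [hR]
  φ₂_M := by simp [hM]
  coh := by simp [hJ]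

/-- The isomorphism from `ST(X)` to `X`. -/
def fromST (h2 : (2 : k) ≠ 0) (X : HLTS.{w, u} k) : Hom (X.toLT2 h2).toHLTS X :=
  Hom.ofStrict LinearMap.id
    (LinearMap.snd k X.X₀ X.X₁ ∘ₗ (LinearMap.ker (LinearMap.fst k X.X₀ X.X₁)).subtype)
    (fun h => by
      have hh : h.1.1 = 0 := h.2
      change h.1.1 + X.d h.1.2 = X.d h.1.2
      rw [hh, zero_add])
    (fun _ _ _ => rfl)
    (fun x f y => by
      change ((TObj X.toHLTSData).br₁ (x, 0) (f.1.1, f.1.2) (y, 0)).2 = X.brM x f.1.2 y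
      rw [TObj_br₁]
      simp [arrBr])
    (fun x y f => by
      change ((TObj X.toHLTSData).br₁ (x, 0) (y, 0) (f.1.1, f.1.2)).2 = X.brR x y f.1.2
      rw [TObj_br₁]
      simp [arrBr])
    -- The fundamentor of `T(X)` has `J` as its second coordinate, and the identity removed by `S`
    -- has second coordinate `0`.
    (fun _ _ _ _ _ => sub_zero _)

/-- The isomorphism from `X` to `ST(X)`. -/
def toST (h2 : (2 : k) ≠ 0) (X : HLTS.{w, u} k) : Hom X (X.toLT2 h2).toHLTS :=
  Hom.ofStrict LinearMap.id
    (LinearMap.codRestrict (LinearMap.ker (LinearMap.fst k X.X₀ X.X₁))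
      (LinearMap.inr k X.X₀ X.X₁) fun _ => rfl)
    (fun h => (zero_add (X.d h)).symm)
    (fun _ _ _ => rfl)
    (fun x f y => Subtype.ext (by
      change (0, X.brM x f y) = (TObj X.toHLTSData).br₁ (x, 0) (0, f) (y, 0)
      rw [TObj_br₁]
      simp [arrBr]))
    (fun x y f => Subtype.ext (by
      change (0, X.brR x y f) = (TObj X.toHLTSData).br₁ (x, 0) (y, 0) (0, f)
      rw [TObj_br₁]
      simp [arrBr]))
    (fun _ _ _ _ _ => Subtype.ext (Prod.ext (sub_self _).symm (sub_zero _).symm))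

theorem toST_comp_fromST (h2 : (2 : k) ≠ 0) (X : HLTS.{w, u} k) :
    (X.toST h2).comp (X.fromST h2) = Hom.id X :=
  Hom.ext_data (HomData.ext rfl rfl (by
    ext x y z
    exact add_zero (0 : X.X₁)))

theorem fromST_comp_toST (h2 : (2 : k) ≠ 0) (X : HLTS.{w, u} k) :
    (X.fromST h2).comp (X.toST h2) = Hom.id (X.toLT2 h2).toHLTS :=
  Hom.ext_data (HomData.ext rfl
    -- An element of the kernel of the source map has first coordinate `0`, so the second coordinate
    -- determines it.
    (LinearMap.ext fun f => Subtype.ext (Prod.ext (show (0 : X.X₀) = f.1.1 from f.2.symm) rfl))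
    (LinearMap.ext fun _ => LinearMap.ext fun _ => LinearMap.ext fun _ =>
      Subtype.ext (Prod.ext (add_zero (0 : X.X₀)) (add_zero (0 : X.X₁)))))

theorem fromST_naturality (h2 : (2 : k) ≠ 0) {X Y : HLTS.{w, u} k} (φ : Hom X Y) :
    (φ.toLT2 h2).toHLTS.comp (Y.fromST h2) = (X.fromST h2).comp φ :=
  Hom.ext_data (HomData.ext rfl rfl (LinearMap.ext fun x => LinearMap.ext fun y =>
    LinearMap.ext fun z => by
      change (0 : Y.X₁) + (φ.φ₂ x y z - 0) = φ.φ₂ x y z + φ.φ₁ 0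
      rw [map_zero, zero_add, sub_zero, add_zero]))

theorem eqToHom_comp_τ {A B : HLTS.{w, u} k} {φ ψ χ : Hom A B} (h : φ = ψ) (σ : ψ ⟶ χ) :
    TwoHom.τ (eqToHom h ≫ σ) = TwoHom.τ σ := by
  rw [comp_τ, eqToHom_τ, zero_add]

theorem comp_eqToHom_τ {A B : HLTS.{w, u} k} {φ ψ χ : Hom A B} (σ : φ ⟶ ψ) (h : ψ = χ) :
    TwoHom.τ (σ ≫ eqToHom h) = TwoHom.τ σ := by
  rw [comp_τ, eqToHom_τ, add_zero]

theorem fromST_naturality₂_τ (h2 : (2 : k) ≠ 0) {X Y : HLTS.{w, u} k} {φ ψ : Hom X Y}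
    (σ : TwoHom φ ψ) :
    (TwoHom.whiskerRight (σ.toLT2 h2).toHLTS (Y.fromST h2)).τ =
      (TwoHom.whiskerLeft (X.fromST h2) σ).τ := by
  refine LinearMap.ext fun x => ?_
  change σ.τ x - 0 = σ.τ x
  rw [sub_zero]

/-- The 2-natural isomorphism from `ST` to the identity. -/
def fromSTIso (h2 : (2 : k) ≠ 0) : TwoNatIso
    ((toLT2Functor h2).comp LT2.toHLTSFunctor) (StrictPseudofunctor.id (HLTS.{w, u} k)) where
  app X := X.fromST h2
  inv X := X.toST h2
  app_inv X := X.fromST_comp_toST h2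
  inv_app X := X.toST_comp_fromST h2
  naturality φ := fromST_naturality h2 φ
  naturality₂ σ := twoHom_ext ((comp_eqToHom_τ _ _).trans
    ((fromST_naturality₂_τ h2 σ).trans (eqToHom_comp_τ _ _).symm))

end HLTS

end
end LieTriple

theorem mainTheorem5 (k : Type w) [Field k] (h2 : (2 : k) ≠ 0) :
    ∃ (T : StrictPseudofunctor (LieTriple.HLTS.{w, u} k) (LieTriple.LT2.{w, u} k))
      (S : StrictPseudofunctor (LieTriple.LT2.{w, u} k) (LieTriple.HLTS.{w, u} k)),
      LieTriple.IsExplicitT T ∧ LieTriple.IsExplicitS S ∧ LieTriple.AreTwoEquivalences T S :=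
  ⟨LieTriple.HLTS.toLT2Functor h2, LieTriple.LT2.toHLTSFunctor, LieTriple.HLTS.isExplicitT h2,
    LieTriple.LT2.isExplicitS, ⟨LieTriple.LT2.fromTSIso h2⟩, ⟨LieTriple.HLTS.fromSTIso h2⟩⟩
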